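/- Let $\Pi:L^2(\mathbb R)\to L^2(\mathbb R)$ be the Szegő projector, $\widehat{\Pi f}=\mathbf 1_{[0,\infty)}\hat f$, let $L^2_+=\Pi(L^2(\mathbb R))$ (complex-valued functions), and let $H^1_+=H^1(\mathbb R)\cap L^2_+$ with the norm $\|f\|_{H^1}=(\|f\|_{L^2}^2+\|\partial_xf\|_{L^2}^2)^{1/2}$. Theorem. For every real $m\ge 0$, every $\lambda\in\{1,-1\}$ and every $u_0\in H^1_+$, there exists a unique function $u\in C(\mathbb R;H^1_+)$ solving $$i\partial_tu+\partial_x^2u=\lambda\,\Pi(|u|^{2m}u),\qquad u(0,x)=u_0(x),\qquad (t,x)\in\mathbb R\times\mathbb R .$$ Here the equation is understood in the sense of distributions in $x$, at every time: for every Schwartz function $\varphi$, the function $t\mapsto\int_{\mathbb R}u(t,x)\varphi(x)\,dx$ is differentiable on $\mathbb R$, and for every $t\in\mathbb R$ $$i\frac{d}{dt}\int_{\mathbb R}u(t,x)\varphi(x)\,dx+\int_{\mathbb R}u(t,x)\varphi''(x)\,dx=\lambda\int_{\mathbb R}\Pi\big(|u(t)|^{2m}u(t)\big)(x)\,\varphi(x)\,dx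 .$$ -/

import Mathlib

open MeasureTheory Set Filter Topology TemperedDistribution FourierTransform
open scoped SchwartzMap ENNReal NNReal

noncomputable section

namespace NLSSzego

/-- `L²(ℝ; ℂ)`, with respect to Lebesgue measure. -/
abbrev L2 : Type := Lp ℂ 2 (volume : Measure ℝ)

/-- Multiplication by the indicator function of `[0, ∞)`, as a linear map on `L²(ℝ)`. -/
def cutoff : L2 →ₗ[ℂ] L2 where
  toFun g := ((Lp.memLp g).indicator (measurableSet_Ici (a := (0 : ℝ)))).toLp
  map_add' f g := by
    rw [← MemLp.toLp_add, MemLp.toLp_eq_toLp_iff]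
    filter_upwards [Lp.coeFn_add f g] with x hx
    by_cases h : x ∈ Ici (0 : ℝ)
    · simp only [Pi.add_apply, Set.indicator_of_mem h, hx]
    · simp only [Pi.add_apply, Set.indicator_of_notMem h, add_zero]
  map_smul' c f := by
    rw [RingHom.id_apply, ← MemLp.toLp_const_smul, MemLp.toLp_eq_toLp_iff]
    filter_upwards [Lp.coeFn_smul c f] with x hx
    by_cases h : x ∈ Ici (0 : ℝ)
    · simp only [Pi.smul_apply, Set.indicator_of_mem h, hx]
    · simp only [Pi.smul_apply, Set.indicator_of_notMem h, smul_zero]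

/-- The Szegő projector `Π` on `L²(ℝ)`: it keeps the nonnegative frequencies,
`(Π f)^ = 1_{[0, ∞)} f^`. The normalisation of the Fourier transform (Mathlib's kernel is
`e^{-2πixξ}`) is immaterial, because rescaling the frequency by `2π > 0` preserves `[0, ∞)`. -/
def szego : L2 →ₗ[ℂ] L2 where
  toFun f := 𝓕⁻ (cutoff (𝓕 f))
  map_add' f g := by
    rw [FourierTransform.fourier_add, map_add, FourierTransform.fourierInv_add]
  map_smul' c f := by
    rw [FourierTransform.fourier_smul, map_smul, FourierTransform.fourierInv_smul,
      RingHom.id_apply]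

/-- The Hardy space `L²₊ = Π(L²(ℝ))`. -/
def hardyL2 : Submodule ℂ L2 := LinearMap.range szego

/-- The space `H¹₊ = H¹(ℝ) ∩ L²₊`. An element `f` is represented by the pair `(f, ∂ₓf)` of `f` and
its weak derivative, both in `L²(ℝ)`; the weak derivative is determined by `f`. The norm inherited
from the Hilbert sum `L² ⊕ L²` is the usual one,
`‖f‖_{H¹} = (‖f‖_{L²}² + ‖∂ₓf‖_{L²}²)^{1/2}`. -/
def H1Plus : Submodule ℂ (WithLp 2 (L2 × L2)) where
  carrier := {p | p.fst ∈ hardyL2 ∧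
    TemperedDistribution.derivCLM ℂ (p.fst : 𝓢'(ℝ, ℂ)) = (p.snd : 𝓢'(ℝ, ℂ))}
  zero_mem' := by
    refine ⟨hardyL2.zero_mem, ?_⟩
    simp only [← Lp.toTemperedDistributionCLM_apply, WithLp.zero_fst, WithLp.zero_snd, map_zero]
  add_mem' := by
    rintro p q ⟨hp, hp'⟩ ⟨hq, hq'⟩
    refine ⟨hardyL2.add_mem hp hq, ?_⟩
    simp only [← Lp.toTemperedDistributionCLM_apply, WithLp.add_fst, WithLp.add_snd, map_add]
      at hp' hq' ⊢
    rw [hp', hq']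
  smul_mem' := by
    rintro c p ⟨hp, hp'⟩
    refine ⟨hardyL2.smul_mem c hp, ?_⟩
    simp only [← Lp.toTemperedDistributionCLM_apply, WithLp.smul_fst, WithLp.smul_snd, map_smul]
      at hp' ⊢
    rw [hp']

/-- The `L²` function underlying an element of `H¹₊`. -/
def toL2 (f : H1Plus) : L2 := (f : WithLp 2 (L2 × L2)).fst

lemma lineDeriv_eq_deriv (f : 𝓢'(ℝ, ℂ)) :
    LineDeriv.lineDerivOp (1 : ℝ) f = TemperedDistribution.derivCLM ℂ f := by
  ext g
  rw [lineDerivOp_apply_apply, derivCLM_apply_apply]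
  congr 2

lemma memSobolev_toL2 (f : H1Plus) : MemSobolev 1 2 (toL2 f : 𝓢'(ℝ, ℂ)) := by
  have h0 : ∀ g : L2, MemSobolev 0 2 (g : 𝓢'(ℝ, ℂ)) := fun g => memSobolev_zero_iff.2 ⟨g, rfl⟩
  set F : 𝓢'(ℝ, ℂ) := (toL2 f : 𝓢'(ℝ, ℂ)) with hF
  have hd : LineDeriv.lineDerivOp (1 : ℝ) F = ((f : WithLp 2 (L2 × L2)).snd : 𝓢'(ℝ, ℂ)) := by
    rw [lineDeriv_eq_deriv]
    exact f.2.2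
  have h1 : MemSobolev (-1) 2 (LineDeriv.lineDerivOp (1 : ℝ) (LineDeriv.lineDerivOp (1 : ℝ) F)) := by
    have := (h0 (f : WithLp 2 (L2 × L2)).snd).lineDerivOp (m := (1 : ℝ))
    rw [← hd] at this
    simpa using this
  have h2 : besselPotential ℝ ℂ 2 F =
      F + (-(1 / (2 * Real.pi) ^ 2 : ℂ)) •
        LineDeriv.lineDerivOp (1 : ℝ) (LineDeriv.lineDerivOp (1 : ℝ) F) := by
    rw [lineDeriv_eq_fourierMultiplierCLM, lineDeriv_eq_fourierMultiplierCLM, map_smul,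
      fourierMultiplierCLM_fourierMultiplierCLM_apply (by fun_prop) (by fun_prop), smul_smul,
      smul_smul, besselPotential]
    have hc : -(1 / (2 * Real.pi) ^ 2 : ℂ) * (2 * Real.pi * Complex.I) *
        (2 * Real.pi * Complex.I) = 1 := by
      have : (Real.pi : ℂ) ≠ 0 := by exact_mod_cast Real.pi_ne_zero
      field_simp
      simp
    rw [hc, one_smul]
    have hs : (fun x : ℝ => (((1 + ‖x‖ ^ 2) ^ ((2 : ℝ) / 2) : ℝ) : ℂ)) =
        fun x => ∑ i : Fin 2, (![fun _ => 1, (fun x : ℝ => ((inner ℝ x 1 : ℝ) : ℂ)) *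
          fun x : ℝ => ((inner ℝ x 1 : ℝ) : ℂ)] : Fin 2 → ℝ → ℂ) i x := by
      funext x
      simp [sq]
    rw [hs, fourierMultiplierCLM_sum]
    · simp
    · intro i _
      fin_cases i
      · simp only [Fin.zero_eta, Matrix.cons_val_zero]
        fun_prop
      · simp only [Fin.mk_one, Matrix.cons_val_one, Matrix.cons_val_zero]
        fun_prop
  have h3 : MemSobolev (-1) 2 (besselPotential ℝ ℂ 2 F) := by
    rw [h2]
    exact ((h0 (toL2 f)).mono (by norm_num)).add (h1.smul _)
  rw [memSobolev_besselPotential_iff] at h3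
  norm_num at h3
  exact h3

/-- Functions of `H¹₊` are essentially bounded. -/
lemma memLp_top_toL2 (f : H1Plus) : MemLp (toL2 f) ∞ (volume : Measure ℝ) := by
  obtain ⟨v, hv⟩ := (memSobolev_toL2 f).fourier_memL1 (by simp)
  have hvi : Integrable v volume := L1.integrable_coeFn v
  have hae : ∀ᵐ x ∂(volume : Measure ℝ), toL2 f x = 𝓕⁻ (v : ℝ → ℂ) x := by
    have hint : LocallyIntegrable (𝓕⁻ (v : ℝ → ℂ)) volume :=
      (VectorFourier.fourierIntegral_continuous Real.continuous_fourierChar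
        (by fun_prop) hvi).locallyIntegrable
    refine ae_eq_of_integral_contDiff_smul_eq ((Lp.memLp (toL2 f)).locallyIntegrable (by norm_num))
      hint ?_
    intro g g_smooth g_cpt
    have hg₁ : HasCompactSupport (Complex.ofRealCLM ∘ g) := g_cpt.comp_left rfl
    have hg₂ : ContDiff ℝ (⊤ : ℕ∞) (Complex.ofRealCLM ∘ g) := by fun_prop
    set G : 𝓢(ℝ, ℂ) := hg₁.toSchwartzMap hg₂ with hG
    have e1 : ∫ x, g x • toL2 f x = (toL2 f : 𝓢'(ℝ, ℂ)) G := by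
      simp [G]
    have e2 : (toL2 f : 𝓢'(ℝ, ℂ)) G = (v : 𝓢'(ℝ, ℂ)) (𝓕⁻ G) := by
      rw [← hv]
      simp
    have e3 := VectorFourier.integral_fourierIntegral_smul_eq_flip (L := -innerₗ ℝ)
      (f := (G : ℝ → ℂ)) (μ := volume) (ν := volume)
      Real.continuous_fourierChar (by fun_prop) G.integrable hvi
    rw [e1, e2, Lp.toTemperedDistribution_apply]
    rw [SchwartzMap.fourierInv_coe]
    refine Eq.trans e3 ?_
    refine integral_congr_ae (Eventually.of_forall fun x => ?_)
    have e4 : VectorFourier.fourierIntegral Real.fourierChar volume (-innerₗ ℝ).flip v x =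
        𝓕⁻ (v : ℝ → ℂ) x := by
      rw [Real.fourierInv_eq]
      simp [VectorFourier.fourierIntegral, mul_comm]
    simp only [e4]
    simp [G]
  refine memLp_top_of_bound (Lp.aestronglyMeasurable _) (∫ x, ‖v x‖) ?_
  filter_upwards [hae] with x hx
  rw [hx, Real.fourierInv_eq]
  refine (norm_integral_le_integral_norm _).trans (le_of_eq ?_)
  simp

/-- For `u ∈ H¹₊` and `m ≥ 0`, the function `|u|^{2m} u` is square integrable. -/
lemma memLp_power (m : ℝ≥0) (f : H1Plus) :
    MemLp (fun x => ((‖toL2 f x‖ ^ (2 * (m : ℝ)) : ℝ) : ℂ) * toL2 f x) 2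
      (volume : Measure ℝ) := by
  have hb := memLp_top_toL2 f
  refine MemLp.of_le_mul (c := (eLpNorm (toL2 f) ∞ volume).toReal ^ (2 * (m : ℝ)))
    (Lp.memLp (toL2 f)) ?_ ?_
  · have := (Lp.aestronglyMeasurable (toL2 f)).aemeasurable
    exact AEMeasurable.aestronglyMeasurable (by fun_prop)
  · filter_upwards [ae_le_eLpNormEssSup (f := toL2 f) (μ := volume)] with x hx
    rw [norm_mul, Complex.norm_real, Real.norm_of_nonneg (by positivity)]
    gcongr
    rw [← eLpNorm_exponent_top] at hx
    rw [← toReal_enorm]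
    exact ENNReal.toReal_mono hb.2.ne hx

/-- The nonlinearity `|u|^{2m} u`, as an element of `L²(ℝ)`, for `u ∈ H¹₊`. -/
def power (m : ℝ≥0) (f : H1Plus) : L2 := (memLp_power m f).toLp

/-- `u ∈ C(ℝ; H¹₊)` solves `i ∂ₜu + ∂ₓ²u = λ Π(|u|^{2m} u)` on `ℝ × ℝ`, with the equation read in
the space of tempered distributions in `x`, at every time `t`: for every Schwartz function `φ`,
the function `t ↦ ⟨u(t), φ⟩ = ∫ u(t, x) φ(x) dx` is differentiable and
`i (d/dt) ⟨u(t), φ⟩ + ⟨∂ₓ²u(t), φ⟩ = λ ⟨Π(|u(t)|^{2m} u(t)), φ⟩`. -/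
def IsSolution (m : ℝ≥0) (lam : ℝ) (u : C(ℝ, H1Plus)) : Prop :=
  ∀ (φ : 𝓢(ℝ, ℂ)) (t : ℝ), ∃ d : ℂ,
    HasDerivAt (fun s => (toL2 (u s) : 𝓢'(ℝ, ℂ)) φ) d t ∧
    Complex.I * d +
        TemperedDistribution.derivCLM ℂ (TemperedDistribution.derivCLM ℂ
          (toL2 (u t) : 𝓢'(ℝ, ℂ))) φ =
      (lam : ℂ) * (szego (power m (u t)) : 𝓢'(ℝ, ℂ)) φ

end NLSSzego

end

/-!
The proof works on the Fourier side, where `v = 𝓕 u` is supported in `[0, ∞)` and `∂ₓ` is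
multiplication by `i · 2πξ` (`freq`). In the interaction picture `V(t) = e^{it(2πξ)²} v(t)` the
Laplacian disappears and the equation becomes an ordinary differential equation
`V' = -iλ 1_{[0,∞)} e^{it(2πξ)²} 𝓕 F(u)` in `L²`. Since `F(u) = |u|^{2m} u` does not map `L²` to
itself, `F` is first replaced by `min(|u|, B)^{2m} u`, which is globally Lipschitz on `L²`; the
field is then globally Lipschitz as well, and global integral curves exist and are unique
(`exists_global_integralCurve`). The truncation is harmless once `u` is known to be bounded by `B`.

*A priori bound.* The truncated nonlinearity is the gradient of a potential energy `J` on `L²`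
(`hasDerivAt_potEnergy`) which is invariant under phase rotations and translations. Cutting the
equation to frequencies in `[0, n]` makes all operators bounded and keeps the Hamiltonian structure,
so that mass, momentum and energy are conserved (`norm_band_eq`, `momentum_band_eq`,
`energy_band_eq`). The frequencies being nonnegative, the momentum `∫ 2πξ |v|²` is the square of the
homogeneous `H^{1/2}` norm. This is what makes the problem globally well posed for every power and
both signs: by the Brezis–Gallouët type inequality `exists_integral_norm_le`, an `H^{1/2}` bound
allows `‖u‖_∞` to grow only like an arbitrarily small power of the `H¹` norm, whence `J` is at most
linear in the `H¹` norm, and the energy, quadratic in it, bounds it. The bound `exists_uniform_bound`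
depends neither on `n` nor on `B`, so `B` can be chosen afterwards.

*Limit and continuity.* Since `F` is Lipschitz on `L²` and commutes with translations, it maps `H¹`
to `H¹` without any differentiation of `F` (`exists_mulEq_freq_fnl`); this covers small `m`, where
`F` is barely `C¹`. Hence the band limited solutions are approximate integral curves with an error
`O(1/n)`, and Grönwall's inequality gives their convergence to the integral curve of the full
equation, which inherits the `H¹` bound (`exists_bound_flow`). As `V'` is bounded in `H¹`, the curve
`V` is Lipschitz with values in `H¹` (`continuous_freq_flow`), and the continuity of
`u = 𝓕⁻(e^{-it(2πξ)²} V)` in `H¹` follows from the strong continuity of the free group.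

*Uniqueness.* A continuous `H¹` solution is bounded on compact time intervals, hence solves a
truncated equation there. Testing the weak equation with `e^{-it(2πξ)²} ψ` for a test function `ψ`
shows that `V` is an integral curve in `L²` (`hasDerivAt_of_weak`), and integral curves of Lipschitz
fields are unique.
-/

noncomputable section

namespace NLSSzego

/-! ### Globally Lipschitz differential equations -/

section ODE

variable {E : Type*} [NormedAddCommGroup E] [NormedSpace ℝ E]

lemma norm_intervalIntegral_le_exp_abs {g : ℝ → E} {C k : ℝ} (hC : 0 ≤ C) (hk : 0 < k)
    (hg : ∀ s, ‖g s‖ ≤ C * Real.exp (k * |s|)) (t : ℝ) :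
    ‖∫ s in (0 : ℝ)..t, g s‖ ≤ C / k * Real.exp (k * |t|) := by
  have key : ∀ h : ℝ → E, (∀ s, ‖h s‖ ≤ C * Real.exp (k * |s|)) → ∀ t, 0 ≤ t →
      ‖∫ s in (0 : ℝ)..t, h s‖ ≤ C / k * Real.exp (k * |t|) := by
    intro h hh t ht
    have h1 : ‖∫ s in (0 : ℝ)..t, h s‖ ≤ ∫ s in (0 : ℝ)..t, C * Real.exp (k * s) := by
      refine intervalIntegral.norm_integral_le_of_norm_le ht ?_
        (Continuous.intervalIntegrable (by fun_prop) _ _)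
      refine Eventually.of_forall fun s hs => ?_
      have := hh s
      rwa [abs_of_pos hs.1] at this
    refine h1.trans ?_
    have h2 : ∫ s in (0 : ℝ)..t, C * Real.exp (k * s) =
        C / k * Real.exp (k * t) - C / k * Real.exp (k * 0) := by
      refine intervalIntegral.integral_eq_sub_of_hasDerivAt (f := fun s => C / k * Real.exp (k * s))
        (fun s _ => ?_) (Continuous.intervalIntegrable (by fun_prop) _ _)
      have := (((hasDerivAt_id s).const_mul k).exp).const_mul (C / k)
      refine this.congr_deriv ?_
      simp only [id]
      field_simp
    rw [h2, abs_of_nonneg ht]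
    have : 0 ≤ C / k * Real.exp (k * 0) := by positivity
    linarith
  rcases le_total 0 t with ht | ht
  · exact key g hg t ht
  · have := key (fun s => g (-s)) (fun s => by simpa using hg (-s)) (-t) (by linarith)
    rw [intervalIntegral.integral_comp_neg] at this
    rw [intervalIntegral.integral_symm, norm_neg]
    simpa using this

/-- A globally Lipschitz, time dependent vector field which vanishes at the origin has global
integral curves. The Picard map is a contraction for the weighted norm
`sup_t e^{-k|t|} ‖x t‖` as soon as `k` exceeds the Lipschitz constant, so that no gluing of local
solutions is needed. -/
theorem exists_global_integralCurve [CompleteSpace E] {f : ℝ → E → E} {K : ℝ≥0}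
    (hlip : ∀ t, LipschitzWith K (f t)) (hcont : Continuous (Function.uncurry f))
    (h0 : ∀ t, f t 0 = 0) (x₀ : E) :
    ∃ x : ℝ → E, x 0 = x₀ ∧ ∀ t, HasDerivAt x (f t (x t)) t := by
  set k : ℝ := 2 * K + 1 with hk
  have hk0 : 0 < k := by positivity
  have hfb : ∀ t x, ‖f t x‖ ≤ K * ‖x‖ := fun t x => by
    have := (hlip t).dist_le_mul x 0
    simpa [h0 t] using this
  -- `lift y` undoes the exponential weight
  set lift : (ℝ → E) → ℝ → E := fun y s => Real.exp (k * |s|) • y s with hlift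
  have hliftc : ∀ y : BoundedContinuousFunction ℝ E, Continuous (lift y) := fun y => by
    simp only [hlift]; fun_prop
  have hfc : ∀ y : BoundedContinuousFunction ℝ E, Continuous fun s => f s (lift y s) := fun y =>
    hcont.comp (continuous_id.prodMk (hliftc y))
  have hliftn : ∀ (y : ℝ → E) s, ‖lift y s‖ = Real.exp (k * |s|) * ‖y s‖ := fun y s => by
    simp only [hlift, norm_smul, Real.norm_eq_abs, Real.abs_exp]
  have hprimc : ∀ y : BoundedContinuousFunction ℝ E,
      Continuous fun t => ∫ s in (0 : ℝ)..t, f s (lift y s) := fun y =>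
    intervalIntegral.continuous_primitive (fun a b => (hfc y).intervalIntegrable a b) 0
  have hcancel : ∀ t, Real.exp (-(k * |t|)) * Real.exp (k * |t|) = 1 := fun t => by
    rw [← Real.exp_add]; simp
  let Pic : BoundedContinuousFunction ℝ E → BoundedContinuousFunction ℝ E := fun y =>
    BoundedContinuousFunction.ofNormedAddCommGroup
      (fun t => Real.exp (-(k * |t|)) • (x₀ + ∫ s in (0 : ℝ)..t, f s (lift y s)))
      (by have := hprimc y; fun_prop) (‖x₀‖ + K * ‖y‖ / k) (fun t => by
        have h1 := norm_intervalIntegral_le_exp_abs (g := fun s => f s (lift y s)) (C := K * ‖y‖)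
          (by positivity) hk0 (fun s => by
            refine (hfb _ _).trans ?_
            rw [hliftn]
            have := y.norm_coe_le_norm s
            calc (K : ℝ) * (Real.exp (k * |s|) * ‖y s‖) ≤ K * (Real.exp (k * |s|) * ‖y‖) := by
                  gcongr
              _ = _ := by ring) t
        rw [norm_smul, Real.norm_eq_abs, Real.abs_exp]
        have h2 : Real.exp (-(k * |t|)) ≤ 1 := Real.exp_le_one_iff.2 (by
          have : 0 ≤ k * |t| := by positivity
          linarith)
        calc Real.exp (-(k * |t|)) * ‖x₀ + ∫ s in (0 : ℝ)..t, f s (lift y s)‖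
            ≤ Real.exp (-(k * |t|)) * (‖x₀‖ + K * ‖y‖ / k * Real.exp (k * |t|)) := by
              gcongr
              exact (norm_add_le _ _).trans (by gcongr)
          _ = Real.exp (-(k * |t|)) * ‖x₀‖ +
              K * ‖y‖ / k * (Real.exp (-(k * |t|)) * Real.exp (k * |t|)) := by ring
          _ ≤ 1 * ‖x₀‖ + K * ‖y‖ / k * 1 := by rw [hcancel]; gcongr
          _ = _ := by ring)
  have hPic : ∀ y t, Pic y t =
      Real.exp (-(k * |t|)) • (x₀ + ∫ s in (0 : ℝ)..t, f s (lift y s)) := fun y t => rfl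
  have hcontr : ContractingWith (1 / 2 : ℝ≥0) Pic := by
    refine ⟨by norm_num, LipschitzWith.of_dist_le_mul fun y z => ?_⟩
    rw [BoundedContinuousFunction.dist_le (by positivity)]
    intro t
    rw [hPic, hPic, dist_eq_norm, ← smul_sub, add_sub_add_left_eq_sub,
      ← intervalIntegral.integral_sub ((hfc y).intervalIntegrable _ _)
        ((hfc z).intervalIntegrable _ _), norm_smul, Real.norm_eq_abs, Real.abs_exp]
    have h1 := norm_intervalIntegral_le_exp_abs (g := fun s => f s (lift y s) - f s (lift z s))
      (C := K * dist y z) (by positivity) hk0 (fun s => by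
        rw [← dist_eq_norm]
        refine ((hlip s).dist_le_mul _ _).trans ?_
        rw [dist_eq_norm]
        simp only [hlift]
        rw [← smul_sub, norm_smul, Real.norm_eq_abs, Real.abs_exp, ← dist_eq_norm]
        have := BoundedContinuousFunction.dist_coe_le_dist (f := y) (g := z) s
        calc (K : ℝ) * (Real.exp (k * |s|) * dist (y s) (z s))
            ≤ K * (Real.exp (k * |s|) * dist y z) := by gcongr
          _ = _ := by ring) t
    calc _ ≤ Real.exp (-(k * |t|)) * (K * dist y z / k * Real.exp (k * |t|)) := by gcongr
      _ = K / k * dist y z * (Real.exp (-(k * |t|)) * Real.exp (k * |t|)) := by ring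
      _ = K / k * dist y z := by rw [hcancel, mul_one]
      _ ≤ 1 / 2 * dist y z := by
          refine mul_le_mul_of_nonneg_right ?_ dist_nonneg
          rw [div_le_iff₀ hk0, hk]
          linarith
      _ = _ := by norm_num
  obtain ⟨y, hy⟩ : ∃ y, Pic y = y :=
    ⟨ContractingWith.fixedPoint Pic hcontr, hcontr.fixedPoint_isFixedPt⟩
  have hx : lift y = fun t => x₀ + ∫ s in (0 : ℝ)..t, f s (lift y s) := by
    funext t
    have h1 := hPic y t
    rw [hy] at h1
    simp only [hlift] at h1 ⊢
    rw [h1, smul_smul, mul_comm, hcancel, one_smul]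
  refine ⟨lift y, ?_, fun t => ?_⟩
  · rw [hx]; simp
  · have h1 : HasDerivAt (fun t => x₀ + ∫ s in (0 : ℝ)..t, f s (lift y s)) (f t (lift y t)) t :=
      ((hfc y).integral_hasStrictDerivAt 0 t).hasDerivAt.const_add x₀
    rwa [← hx] at h1

/-- Grönwall's comparison of an exact with an approximate integral curve, in both directions of
time. -/
theorem dist_le_gronwallBound_abs {f : ℝ → E → E} {K : ℝ≥0} {x y y' : ℝ → E} {δ ε : ℝ}
    (hlip : ∀ t, LipschitzWith K (f t)) (hx : ∀ t, HasDerivAt x (f t (x t)) t)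
    (hy : ∀ t, HasDerivAt y (y' t) t) (hε : ∀ t, dist (y' t) (f t (y t)) ≤ ε)
    (hδ : dist (x 0) (y 0) ≤ δ) (t : ℝ) :
    dist (x t) (y t) ≤ gronwallBound δ K ε |t| := by
  have key : ∀ (f : ℝ → E → E) (x y y' : ℝ → E), (∀ t, LipschitzWith K (f t)) →
      (∀ t, HasDerivAt x (f t (x t)) t) → (∀ t, HasDerivAt y (y' t) t) →
      (∀ t, dist (y' t) (f t (y t)) ≤ ε) → dist (x 0) (y 0) ≤ δ → ∀ t, 0 ≤ t →
      dist (x t) (y t) ≤ gronwallBound δ K ε t := by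
    intro f x y y' hlip hx hy hε hδ t ht
    have := dist_le_of_approx_trajectories_ODE (v := f) (K := K) (f := x) (g := y) (a := 0)
      (b := t) (f' := fun t => f t (x t)) (g' := y') (εf := 0) (εg := ε) (δ := δ) hlip
      (fun s _ => (hx s).continuousAt.continuousWithinAt) (fun s _ => (hx s).hasDerivWithinAt)
      (fun s _ => by simp) (fun s _ => (hy s).continuousAt.continuousWithinAt)
      (fun s _ => (hy s).hasDerivWithinAt) (fun s _ => hε s) hδ t ⟨ht, le_rfl⟩
    simpa using this
  rcases le_total 0 t with ht | ht
  · rw [abs_of_nonneg ht]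
    exact key f x y y' hlip hx hy hε hδ t ht
  · rw [abs_of_nonpos ht]
    have hrev : ∀ {z z' : ℝ → E}, (∀ t, HasDerivAt z (z' t) t) →
        ∀ t, HasDerivAt (fun s => z (-s)) (-z' (-t)) t := fun {z z'} hz t =>
      ((hz (-t)).scomp t (hasDerivAt_neg t)).congr_deriv (by simp)
    have := key (fun s v => -f (-s) v) (fun s => x (-s)) (fun s => y (-s)) (fun s => -y' (-s))
      (fun s => LipschitzWith.of_dist_le_mul fun a b => by
        rw [dist_neg_neg]; exact (hlip (-s)).dist_le_mul a b)
      (hrev hx) (hrev hy) (fun s => by rw [dist_neg_neg]; exact hε (-s)) (by simpa using hδ)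
      (-t) (by linarith)
    simpa using this

end ODE

/-! ### Multiplication operators on `L²(ℝ)` -/

/-- The bounded measurable functions, which act on `L²(ℝ)` by multiplication. -/
structure IsMultiplier (a : ℝ → ℂ) : Prop where
  measurable : Measurable a
  bdd : ∃ C : ℝ, ∀ x, ‖a x‖ ≤ C

lemma IsMultiplier.memLp {a : ℝ → ℂ} (ha : IsMultiplier a) (f : L2) :
    MemLp (fun x => a x * f x) 2 (volume : Measure ℝ) := by
  obtain ⟨C, hC⟩ := ha.bdd
  refine MemLp.of_le_mul (c := C) (Lp.memLp f)
    (ha.measurable.aestronglyMeasurable.mul (Lp.aestronglyMeasurable f))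
    (Eventually.of_forall fun x => ?_)
  rw [norm_mul]
  gcongr
  exact hC x

lemma IsMultiplier.mul {a b : ℝ → ℂ} (ha : IsMultiplier a) (hb : IsMultiplier b) :
    IsMultiplier (fun x => a x * b x) := by
  obtain ⟨C, hC⟩ := ha.bdd
  obtain ⟨D, hD⟩ := hb.bdd
  refine ⟨ha.measurable.mul hb.measurable, C * D, fun x => ?_⟩
  rw [norm_mul]
  have := (norm_nonneg _).trans (hC x)
  gcongr
  exacts [hC x, hD x]

lemma norm_le_of_ae_le {f g : L2} {C : ℝ} (h : ∀ᵐ x, ‖f x‖ ≤ C * ‖g x‖) : ‖f‖ ≤ C * ‖g‖ :=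
  Lp.norm_le_mul_norm_of_ae_le_mul h

open Classical in
/-- Multiplication by `a`, as a bounded operator on `L²(ℝ)`; it is zero by convention if `a` is not
a bounded measurable function. -/
def mulOp (a : ℝ → ℂ) : L2 →L[ℂ] L2 :=
  if ha : IsMultiplier a then
    LinearMap.mkContinuous
      { toFun := fun f => (ha.memLp f).toLp
        map_add' := fun f g => by
          rw [← MemLp.toLp_add, MemLp.toLp_eq_toLp_iff]
          filter_upwards [Lp.coeFn_add f g] with x hx
          simp only [hx, Pi.add_apply, mul_add]
        map_smul' := fun c f => by
          rw [RingHom.id_apply, ← MemLp.toLp_const_smul, MemLp.toLp_eq_toLp_iff]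
          filter_upwards [Lp.coeFn_smul c f] with x hx
          simp only [hx, Pi.smul_apply, smul_eq_mul]
          ring }
      ha.bdd.choose (fun f => norm_le_of_ae_le (by
        filter_upwards [(ha.memLp f).coeFn_toLp] with x hx
        simp only [LinearMap.coe_mk, AddHom.coe_mk, hx, norm_mul]
        gcongr
        exact ha.bdd.choose_spec x))
  else 0

lemma coeFn_mulOp {a : ℝ → ℂ} (ha : IsMultiplier a) (f : L2) :
    mulOp a f =ᵐ[volume] fun x => a x * f x := by
  have : mulOp a f = (ha.memLp f).toLp := by simp [mulOp, ha]
  rw [this]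
  exact (ha.memLp f).coeFn_toLp

lemma mulOp_eq_iff {a : ℝ → ℂ} (ha : IsMultiplier a) {f g : L2} :
    mulOp a f = g ↔ g =ᵐ[volume] fun x => a x * f x := by
  constructor
  · rintro rfl; exact coeFn_mulOp ha f
  · intro h; exact Lp.ext ((coeFn_mulOp ha f).trans h.symm)

lemma norm_mulOp_le {a : ℝ → ℂ} (ha : IsMultiplier a) {C : ℝ} (hC : ∀ x, ‖a x‖ ≤ C) (f : L2) :
    ‖mulOp a f‖ ≤ C * ‖f‖ :=
  norm_le_of_ae_le (by
    filter_upwards [coeFn_mulOp ha f] with x hx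
    rw [hx, norm_mul]
    gcongr
    exact hC x)

lemma norm_mulOp_eq {a : ℝ → ℂ} (ha : IsMultiplier a) (h1 : ∀ x, ‖a x‖ = 1) (f : L2) :
    ‖mulOp a f‖ = ‖f‖ := by
  refine le_antisymm ?_ ?_
  · simpa using norm_mulOp_le ha (fun x => (h1 x).le) f
  · have : ‖f‖ ≤ 1 * ‖mulOp a f‖ := norm_le_of_ae_le (by
      filter_upwards [coeFn_mulOp ha f] with x hx
      rw [hx, norm_mul, h1, one_mul, one_mul])
    simpa using this

lemma mulOp_mulOp {a b : ℝ → ℂ} (ha : IsMultiplier a) (hb : IsMultiplier b) (f : L2) :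
    mulOp a (mulOp b f) = mulOp (fun x => a x * b x) f := by
  rw [mulOp_eq_iff ha]
  filter_upwards [coeFn_mulOp hb f, coeFn_mulOp (ha.mul hb) f] with x h1 h2
  rw [h1, h2]; ring

lemma mulOp_comm {a b : ℝ → ℂ} (ha : IsMultiplier a) (hb : IsMultiplier b) (f : L2) :
    mulOp a (mulOp b f) = mulOp b (mulOp a f) := by
  rw [mulOp_mulOp ha hb, mulOp_mulOp hb ha]
  congr 1
  simp only [mul_comm]

/-- Moving a multiplication operator to the other side of the inner product. -/
lemma inner_mulOp {a b : ℝ → ℂ} (ha : IsMultiplier a) (hb : IsMultiplier b)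
    (hab : ∀ x, b x = star (a x)) (f g : L2) :
    inner ℂ (mulOp a f) g = inner ℂ f (mulOp b g) := by
  rw [L2.inner_def, L2.inner_def]
  refine integral_congr_ae ?_
  filter_upwards [coeFn_mulOp ha f, coeFn_mulOp hb g] with x h1 h2
  rw [h1, h2, hab]
  simp only [RCLike.inner_apply, map_mul, Complex.star_def]
  ring

/-- Multiplication by an unbounded function, as a relation: `g = a f` almost everywhere. -/
def MulEq (a : ℝ → ℂ) (f g : L2) : Prop := g =ᵐ[volume] fun x => a x * f x

lemma MulEq.unique {a : ℝ → ℂ} {f g h : L2} (hg : MulEq a f g) (hh : MulEq a f h) : g = h :=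
  Lp.ext (hg.trans hh.symm)

lemma MulEq.sub {a : ℝ → ℂ} {f g f' g' : L2} (h : MulEq a f g) (h' : MulEq a f' g') :
    MulEq a (f - f') (g - g') := by
  unfold MulEq at *
  filter_upwards [h, h', Lp.coeFn_sub f f', Lp.coeFn_sub g g'] with x h1 h2 h3 h4
  rw [h4, h3, Pi.sub_apply, Pi.sub_apply, h1, h2, mul_sub]

lemma MulEq.mulOp {a b : ℝ → ℂ} (hb : IsMultiplier b) {f g : L2} (h : MulEq a f g) :
    MulEq a (mulOp b f) (mulOp b g) := by
  unfold MulEq at *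
  filter_upwards [h, coeFn_mulOp hb f, coeFn_mulOp hb g] with x h1 h2 h3
  rw [h3, h2, h1]; ring

/-- If bounded multipliers `aₙ` converge pointwise to `a` and `‖aₙ f‖ ≤ K`, then `a f` is square
integrable and `‖a f‖ ≤ K`: Fatou's lemma. -/
lemma exists_mulEq_of_tendsto {ι : Type*} {l : Filter ι} [l.NeBot] [l.IsCountablyGenerated]
    {a : ι → ℝ → ℂ} {b : ℝ → ℂ} (ha : ∀ i, IsMultiplier (a i)) (hb : Measurable b)
    (hlim : ∀ x, Tendsto (fun i => a i x) l (𝓝 (b x))) {f : L2} {K : ℝ}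
    (hK : ∀ᶠ i in l, ‖mulOp (a i) f‖ ≤ K) :
    ∃ g : L2, MulEq b f g ∧ ‖g‖ ≤ K := by
  have hK0 : 0 ≤ K := by
    obtain ⟨i, hi⟩ := hK.exists
    exact (norm_nonneg _).trans hi
  have h1 : eLpNorm (fun x => b x * f x) 2 (volume : Measure ℝ) ≤ ENNReal.ofReal K := by
    refine Lp.eLpNorm_le_of_ae_tendsto (u := l) (f := fun i x => a i x * f x) ?_ ?_ ?_
    · filter_upwards [hK] with i hi
      rw [← eLpNorm_congr_ae (coeFn_mulOp (ha i) f)]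
      rw [Lp.norm_def] at hi
      rwa [ENNReal.le_ofReal_iff_toReal_le (Lp.eLpNorm_ne_top _) hK0]
    · intro i
      exact ((ha i).measurable.aestronglyMeasurable).mul (Lp.aestronglyMeasurable f)
    · exact Eventually.of_forall fun x => (hlim x).mul_const _
  have h2 : MemLp (fun x => b x * f x) 2 (volume : Measure ℝ) :=
    ⟨hb.aestronglyMeasurable.mul (Lp.aestronglyMeasurable f), h1.trans_lt ENNReal.ofReal_lt_top⟩
  refine ⟨h2.toLp, h2.coeFn_toLp, ?_⟩
  rw [Lp.norm_toLp]
  exact ENNReal.toReal_le_of_le_ofReal hK0 h1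

lemma norm_sq_eq_integral (f : L2) : ‖f‖ ^ 2 = ∫ x, ‖f x‖ ^ 2 := by
  have h1 : inner ℂ f f = ((∫ x, ‖f x‖ ^ 2 : ℝ) : ℂ) := by
    rw [L2.inner_def]
    refine (integral_congr_ae (Eventually.of_forall fun x => ?_)).trans
      (integral_ofReal (𝕜 := ℂ) (f := fun x => ‖f x‖ ^ 2))
    simp only [inner_self_eq_norm_sq_to_K]
    simp
  have h2 := inner_self_eq_norm_sq_to_K (𝕜 := ℂ) f
  rw [h1] at h2
  have h3 := congrArg Complex.re h2
  simp only [Complex.ofReal_re] at h3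
  rw [h3]
  norm_cast

lemma integrable_norm_sq (f : L2) : Integrable (fun x => ‖f x‖ ^ 2) (volume : Measure ℝ) :=
  (Lp.memLp f).integrable_norm_pow (by norm_num)

/-- Dominated convergence in `L²`, for products `aᵢ f`. -/
lemma tendsto_of_mulEq_of_dominated {ι : Type*} {l : Filter ι} [l.IsCountablyGenerated]
    {a : ι → ℝ → ℂ} {b : ℝ → ℂ} {c : ℝ → ℝ} {F : ι → L2} {f g h : L2}
    (hF : ∀ i, MulEq (a i) f (F i)) (hg : MulEq b f g) (hac : ∀ᶠ i in l, ∀ x, ‖a i x‖ ≤ c x)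
    (hc : ∀ᵐ x, ‖h x‖ = c x * ‖f x‖) (hlim : ∀ x, Tendsto (fun i => a i x) l (𝓝 (b x))) :
    Tendsto F l (𝓝 g) := by
  rcases l.eq_or_neBot with rfl | hl
  · exact tendsto_bot
  have hbc : ∀ x, ‖b x‖ ≤ c x := fun x =>
    le_of_tendsto (hlim x).norm (hac.mono fun i hi => hi x)
  have h1 : Tendsto (fun i => ∫ x, ‖(F i - g) x‖ ^ 2) l (𝓝 (∫ _ : ℝ, (0 : ℝ))) := by
    have h2 : Tendsto (fun i => ∫ x, ‖(a i x - b x) * f x‖ ^ 2) l (𝓝 (∫ _ : ℝ, (0 : ℝ))) := by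
      refine tendsto_integral_filter_of_dominated_convergence (fun x => 4 * ‖h x‖ ^ 2) ?_ ?_
        ((integrable_norm_sq h).const_mul 4) ?_
      · refine Eventually.of_forall fun i => ?_
        refine AEStronglyMeasurable.congr (f := fun x => ‖(F i - g) x‖ ^ 2)
          (integrable_norm_sq _).aestronglyMeasurable ?_
        filter_upwards [Lp.coeFn_sub (F i) g, hF i, hg] with x h1 h2 h3
        rw [h1, Pi.sub_apply, h2, h3, sub_mul]
      · filter_upwards [hac] with i hi
        filter_upwards [hc] with x hx
        rw [Real.norm_of_nonneg (by positivity), hx, norm_mul]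
        have h3 : ‖a i x - b x‖ ≤ 2 * c x :=
          (norm_sub_le _ _).trans (by linarith [hi x, hbc x])
        calc (‖a i x - b x‖ * ‖f x‖) ^ 2 ≤ (2 * c x * ‖f x‖) ^ 2 := by gcongr
          _ = _ := by ring
      · refine Eventually.of_forall fun x => ?_
        have h3 : Tendsto (fun i => ‖(a i x - b x) * f x‖ ^ 2) l
            (𝓝 (‖(b x - b x) * f x‖ ^ 2)) :=
          ((((hlim x).sub_const (b x)).mul_const (f x)).norm).pow 2
        simpa using h3
    refine h2.congr fun i => integral_congr_ae ?_
    filter_upwards [Lp.coeFn_sub (F i) g, hF i, hg] with x h1 h2 h3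
    rw [h1, Pi.sub_apply, h2, h3, sub_mul]
  rw [integral_zero] at h1
  simp only [← norm_sq_eq_integral] at h1
  rw [tendsto_iff_norm_sub_tendsto_zero]
  have h3 := h1.sqrt
  simpa using h3

/-! ### Phase multipliers -/

/-- The multiplier `e^{isq}`. -/
def phase (q : ℝ → ℝ) (s : ℝ) (x : ℝ) : ℂ := Complex.exp (((s * q x : ℝ) : ℂ) * Complex.I)

lemma norm_phase (q : ℝ → ℝ) (s x : ℝ) : ‖phase q s x‖ = 1 := Complex.norm_exp_ofReal_mul_I _

lemma isMultiplier_phase {q : ℝ → ℝ} (hq : Measurable q) (s : ℝ) : IsMultiplier (phase q s) :=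
  ⟨by unfold phase; fun_prop, 1, fun x => (norm_phase q s x).le⟩

lemma phase_mul (q : ℝ → ℝ) (s t x : ℝ) : phase q s x * phase q t x = phase q (s + t) x := by
  rw [phase, phase, phase, ← Complex.exp_add]
  congr 1
  push_cast
  ring

@[simp] lemma phase_zero (q : ℝ → ℝ) (x : ℝ) : phase q 0 x = 1 := by simp [phase]

lemma star_phase (q : ℝ → ℝ) (s x : ℝ) : star (phase q s x) = phase q (-s) x := by
  rw [phase, phase, Complex.star_def, ← Complex.exp_conj]
  congr 1
  simp

lemma norm_mulOp_phase {q : ℝ → ℝ} (hq : Measurable q) (s : ℝ) (f : L2) :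
    ‖mulOp (phase q s) f‖ = ‖f‖ :=
  norm_mulOp_eq (isMultiplier_phase hq s) (norm_phase q s) f

lemma mulOp_phase_mulOp_phase {q : ℝ → ℝ} (hq : Measurable q) (s t : ℝ) (f : L2) :
    mulOp (phase q s) (mulOp (phase q t) f) = mulOp (phase q (s + t)) f := by
  rw [mulOp_mulOp (isMultiplier_phase hq s) (isMultiplier_phase hq t)]
  simp only [phase_mul]

@[simp] lemma mulOp_one (f : L2) : mulOp (fun _ => 1) f = f := by
  rw [mulOp_eq_iff ⟨measurable_const, 1, by simp⟩]
  simp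

@[simp] lemma mulOp_phase_zero (q : ℝ → ℝ) (f : L2) : mulOp (phase q 0) f = f := by
  have : phase q 0 = fun _ => 1 := funext fun x => phase_zero q x
  rw [this, mulOp_one]

lemma inner_mulOp_phase {q : ℝ → ℝ} (hq : Measurable q) (s : ℝ) (f g : L2) :
    inner ℂ (mulOp (phase q s) f) g = inner ℂ f (mulOp (phase q (-s)) g) :=
  inner_mulOp (isMultiplier_phase hq s) (isMultiplier_phase hq (-s))
    (fun x => (star_phase q s x).symm) f g

lemma norm_phase_sub_one_le (q : ℝ → ℝ) (s x : ℝ) : ‖phase q s x - 1‖ ≤ |s| * |q x| := by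
  have := Real.norm_exp_I_mul_ofReal_sub_one_le (x := s * q x)
  rw [mul_comm, Real.norm_eq_abs, abs_mul] at this
  exact this

lemma hasDerivAt_phase (q : ℝ → ℝ) (x s : ℝ) :
    HasDerivAt (fun s => phase q s x) (Complex.I * q x * phase q s x) s := by
  have h1 : HasDerivAt (fun s : ℝ => ((s * q x : ℝ) : ℂ) * Complex.I) (q x * Complex.I) s := by
    have := ((hasDerivAt_id s).mul_const (q x)).ofReal_comp.mul_const Complex.I
    simpa using this
  refine h1.cexp.congr_deriv ?_
  rw [phase]
  ring

lemma tendsto_mulOp_phase {q : ℝ → ℝ} (hq : Measurable q) (s : ℝ) (f : L2) :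
    Tendsto (fun r => mulOp (phase q r) f) (𝓝 s) (𝓝 (mulOp (phase q s) f)) :=
  tendsto_of_mulEq_of_dominated (a := phase q) (b := phase q s) (f := f) (h := f) (c := 1)
    (fun r => coeFn_mulOp (isMultiplier_phase hq r) f) (coeFn_mulOp (isMultiplier_phase hq s) f)
    (Eventually.of_forall fun r x => (norm_phase q r x).le)
    (by simp) (fun x => (hasDerivAt_phase q x s).continuousAt)

/-- The group of multiplications by `e^{isq}` is strongly continuous; it is isometric, whence the
joint continuity. -/
lemma continuous_mulOp_phase_comp {X : Type*} [TopologicalSpace X] {q : ℝ → ℝ} (hq : Measurable q)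
    {s : X → ℝ} {f : X → L2} (hs : Continuous s) (hf : Continuous f) :
    Continuous fun x => mulOp (phase q (s x)) (f x) := by
  rw [continuous_iff_continuousAt]
  intro x
  have h1 : Tendsto (fun y => mulOp (phase q (s y)) (f x)) (𝓝 x)
      (𝓝 (mulOp (phase q (s x)) (f x))) := (tendsto_mulOp_phase hq (s x) (f x)).comp hs.continuousAt
  have h2 : Tendsto (fun y => mulOp (phase q (s y)) (f y - f x)) (𝓝 x) (𝓝 0) := by
    rw [tendsto_zero_iff_norm_tendsto_zero]
    simp only [norm_mulOp_phase hq]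
    have : Tendsto (fun y => f y - f x) (𝓝 x) (𝓝 (f x - f x)) :=
      (hf.continuousAt.tendsto).sub_const _
    rw [sub_self] at this
    simpa using this.norm
  simpa [ContinuousAt] using h1.add h2

lemma hasDerivAt_mulOp_phase {q : ℝ → ℝ} (hq : Measurable q) {f g : L2}
    (hg : MulEq (fun x => Complex.I * q x) f g) (s : ℝ) :
    HasDerivAt (fun s => mulOp (phase q s) f) (mulOp (phase q s) g) s := by
  rw [hasDerivAt_iff_tendsto_slope_zero]
  have h0 : Tendsto (fun h : ℝ => h⁻¹ • (mulOp (phase q h) f - f)) (𝓝[≠] 0) (𝓝 g) := by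
    refine tendsto_of_mulEq_of_dominated
      (a := fun h x => h⁻¹ • (phase q h x - 1)) (b := fun x => Complex.I * q x) (f := f) (h := g)
      (c := fun x => |q x|) (fun h => ?_) hg ?_ ?_ (fun x => ?_)
    · unfold MulEq
      filter_upwards [Lp.coeFn_smul h⁻¹ (mulOp (phase q h) f - f),
        Lp.coeFn_sub (mulOp (phase q h) f) f, coeFn_mulOp (isMultiplier_phase hq h) f]
        with x h1 h2 h3
      rw [h1, Pi.smul_apply, h2, Pi.sub_apply, h3, Complex.real_smul, Complex.real_smul]
      ring
    · filter_upwards [self_mem_nhdsWithin] with h hh x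
      rw [norm_smul, norm_inv, Real.norm_eq_abs]
      have := norm_phase_sub_one_le q h x
      have h0 : 0 < |h| := abs_pos.2 hh
      rw [inv_mul_le_iff₀ h0]
      exact this
    · filter_upwards [hg] with x hx
      rw [hx]
      simp
    · have := (hasDerivAt_phase q x 0).tendsto_slope_zero
      simpa using this
  have h1 := ((mulOp (phase q s)).continuous.tendsto g).comp h0
  refine h1.congr fun h => ?_
  simp only [Function.comp_apply]
  rw [← mulOp_phase_mulOp_phase hq, ← map_sub, ContinuousLinearMap.map_smul_of_tower]

/-- Product rule for `e^{isq} F(s)`, where only the value `F(s)` has to lie in the domain of the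
generator. -/
lemma _root_.HasDerivAt.mulOp_phase {q : ℝ → ℝ} (hq : Measurable q) {F : ℝ → L2} {F' g : L2}
    {c s : ℝ} (hF : HasDerivAt F F' s) (hg : MulEq (fun x => Complex.I * q x) (F s) g) :
    HasDerivAt (fun s => mulOp (phase q (c * s)) (F s))
      (mulOp (phase q (c * s)) F' + c • mulOp (phase q (c * s)) g) s := by
  have h1 : HasDerivAt (fun r => mulOp (phase q (c * r)) (F s))
      (c • mulOp (phase q (c * s)) g) s := by
    have := (hasDerivAt_mulOp_phase hq hg (c * s)).scomp s ((hasDerivAt_id s).const_mul c)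
    exact this.congr_deriv (by simp)
  have h2 : HasDerivAt (fun r => mulOp (phase q (c * r)) (F r - F s))
      (mulOp (phase q (c * s)) F') s := by
    rw [hasDerivAt_iff_tendsto_slope_zero] at hF ⊢
    have h3 : Tendsto (fun h : ℝ => mulOp (phase q (c * (s + h))) F') (𝓝[≠] 0)
        (𝓝 (mulOp (phase q (c * s)) F')) := by
      refine (tendsto_mulOp_phase hq (c * s) F').comp ?_
      have : ContinuousAt (fun h : ℝ => c * (s + h)) 0 := by fun_prop
      simpa [ContinuousAt] using this.tendsto.mono_left nhdsWithin_le_nhds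
    have h4 : Tendsto (fun h : ℝ => mulOp (phase q (c * (s + h))) (h⁻¹ • (F (s + h) - F s) - F'))
        (𝓝[≠] 0) (𝓝 0) := by
      rw [tendsto_zero_iff_norm_tendsto_zero]
      simp only [norm_mulOp_phase hq]
      simpa using (hF.sub_const F').norm
    have h5 := h4.add h3
    rw [zero_add] at h5
    refine h5.congr fun h => ?_
    rw [← map_add, sub_add_cancel, ContinuousLinearMap.map_smul_of_tower]
    simp
  have h3 := h2.add h1
  refine h3.congr_of_eventuallyEq (Eventually.of_forall fun r => ?_)
  simp

/-! ### The truncated nonlinearity -/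

section


/-- The factor `min(r, B)^{2m}`, which agrees with `r^{2m}` for `r ≤ B`. -/
def gain (m B : ℝ≥0) (r : ℝ) : ℝ := min r B ^ (2 * (m : ℝ))

/-- The truncation `min(|z|, B)^{2m} z` of the nonlinearity `|z|^{2m} z`. -/
def truncNL (m B : ℝ≥0) (z : ℂ) : ℂ := (gain m B ‖z‖ : ℂ) * z

/-- A Lipschitz constant of the truncated nonlinearity. -/
def lipNL (m B : ℝ≥0) : ℝ≥0 := (2 * m + 2) * B ^ (2 * (m : ℝ))

variable (m B : ℝ≥0)

lemma gain_nonneg {r : ℝ} (hr : 0 ≤ r) : 0 ≤ gain m B r :=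
  Real.rpow_nonneg (le_min hr B.2) _

lemma gain_le {r : ℝ} (hr : 0 ≤ r) : gain m B r ≤ (B : ℝ) ^ (2 * (m : ℝ)) :=
  Real.rpow_le_rpow (le_min hr B.2) (min_le_right _ _) (by positivity)

lemma gain_mono {r s : ℝ} (hs : 0 ≤ s) (hsr : s ≤ r) : gain m B s ≤ gain m B r :=
  Real.rpow_le_rpow (le_min hs B.2) (min_le_min_right _ hsr) (by positivity)

lemma gain_le_rpow {r s : ℝ} (hr : 0 ≤ r) (hrs : r ≤ s) : gain m B r ≤ s ^ (2 * (m : ℝ)) :=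
  Real.rpow_le_rpow (le_min hr B.2) ((min_le_left _ _).trans hrs) (by positivity)

lemma continuous_gain : Continuous (gain m B) := by
  unfold gain
  exact Continuous.rpow_const (by fun_prop) fun x => Or.inr (by positivity)

lemma rpow_sub_rpow_le {a b p : ℝ} (hb : 0 ≤ b) (hab : b ≤ a) (hp : 0 ≤ p) :
    a ^ (p + 1) - b ^ (p + 1) ≤ (p + 1) * a ^ p * (a - b) := by
  rcases (hb.trans hab).eq_or_lt with ha | ha
  · have : b = 0 := le_antisymm (by linarith) hb
    rw [← ha, this]; simp
  · have h1 := one_add_mul_self_le_rpow_one_add (s := b / a - 1) (p := p + 1)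
      (by have : 0 ≤ b / a := by positivity
          linarith) (by linarith)
    rw [add_sub_cancel, Real.div_rpow hb ha.le, le_div_iff₀ (by positivity)] at h1
    have h2 : a ^ (p + 1) = a ^ p * a := Real.rpow_add_one ha.ne' p
    rw [h2] at h1 ⊢
    have h3 : (1 + (p + 1) * (b / a - 1)) * (a ^ p * a) =
        a ^ p * a + (p + 1) * a ^ p * (b - a) := by
      field_simp
    linarith

lemma gain_sub_gain_mul_le {r s : ℝ} (hs : 0 ≤ s) (hsr : s ≤ r) :
    (gain m B r - gain m B s) * s ≤ (2 * m + 1) * (B : ℝ) ^ (2 * (m : ℝ)) * (r - s) := by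
  have hp : (0 : ℝ) ≤ 2 * (m : ℝ) := by positivity
  have hR : 0 ≤ (2 * m + 1) * (B : ℝ) ^ (2 * (m : ℝ)) * (r - s) :=
    mul_nonneg (by positivity) (by linarith)
  rcases le_total (B : ℝ) s with h | h
  · rw [gain, gain, min_eq_right h, min_eq_right (h.trans hsr), sub_self, zero_mul]
    exact hR
  · have hsr' : s ≤ min r B := le_min hsr h
    have h0 : 0 ≤ min r (B : ℝ) := hs.trans hsr'
    have h1 := rpow_sub_rpow_le hs hsr' hp
    rw [gain, gain, min_eq_left h]
    rw [Real.rpow_add_one' h0 (by linarith), Real.rpow_add_one' hs (by linarith)] at h1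
    have h2 : min r (B : ℝ) ^ (2 * (m : ℝ)) * s ≤ min r (B : ℝ) ^ (2 * (m : ℝ)) * min r B := by
      gcongr
    have h3 : (2 * (m : ℝ) + 1) * min r (B : ℝ) ^ (2 * (m : ℝ)) * (min r B - s) ≤
        (2 * m + 1) * (B : ℝ) ^ (2 * (m : ℝ)) * (r - s) := by
      have : min r (B : ℝ) ≤ r := min_le_left _ _
      have : min r (B : ℝ) ≤ B := min_le_right _ _
      have : 0 ≤ r - s := by linarith
      gcongr
    linarith

lemma lipschitzWith_truncNL : LipschitzWith (lipNL m B) (truncNL m B) := by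
  have key : ∀ z w : ℂ, ‖w‖ ≤ ‖z‖ → ‖truncNL m B z - truncNL m B w‖ ≤ lipNL m B * ‖z - w‖ := by
    intro z w hwz
    have h1 : truncNL m B z - truncNL m B w =
        (gain m B ‖z‖ : ℂ) * (z - w) + ((gain m B ‖z‖ - gain m B ‖w‖ : ℝ) : ℂ) * w := by
      simp only [truncNL]; push_cast; ring
    have h2 := gain_sub_gain_mul_le m B (norm_nonneg w) hwz
    have h3 := gain_mono m B (norm_nonneg w) hwz
    have h4 := gain_le m B (norm_nonneg z)
    have h5 : ‖z‖ - ‖w‖ ≤ ‖z - w‖ := norm_sub_norm_le _ _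
    rw [h1]
    refine (norm_add_le _ _).trans ?_
    rw [norm_mul, norm_mul, Complex.norm_real, Complex.norm_real,
      Real.norm_of_nonneg (gain_nonneg m B (norm_nonneg z)), Real.norm_of_nonneg (by linarith)]
    have h6 : (2 * (m : ℝ) + 1) * (B : ℝ) ^ (2 * (m : ℝ)) * (‖z‖ - ‖w‖) ≤
        (2 * m + 1) * (B : ℝ) ^ (2 * (m : ℝ)) * ‖z - w‖ := by gcongr
    have h7 : gain m B ‖z‖ * ‖z - w‖ ≤ (B : ℝ) ^ (2 * (m : ℝ)) * ‖z - w‖ := by gcongr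
    have h8 : (lipNL m B : ℝ) = (2 * m + 2) * (B : ℝ) ^ (2 * (m : ℝ)) := by
      simp [lipNL]
    rw [h8]
    linarith
  refine LipschitzWith.of_dist_le_mul fun z w => ?_
  rw [dist_eq_norm, dist_eq_norm]
  rcases le_total ‖w‖ ‖z‖ with h | h
  · exact key z w h
  · rw [norm_sub_rev, norm_sub_rev z]; exact key w z h

lemma truncNL_zero : truncNL m B 0 = 0 := by simp [truncNL]

/-- The potential `Φ` of the truncated nonlinearity, `Φ(z) = ∫₀^{|z|} min(r, B)^{2m} r dr`. The
substitution `σ = r²` makes `Φ` visibly a `C¹` function of `|z|²`. -/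
def potential (z : ℂ) : ℝ := (1 / 2) * ∫ σ in (0 : ℝ)..‖z‖ ^ 2, gain m B (Real.sqrt σ)

lemma continuous_gain_sqrt : Continuous fun σ => gain m B (Real.sqrt σ) :=
  (continuous_gain m B).comp Real.continuous_sqrt

lemma continuous_potential : Continuous (potential m B) := by
  have h := intervalIntegral.continuous_primitive
    (fun a b => (continuous_gain_sqrt m B).intervalIntegrable (μ := volume) a b) 0
  exact continuous_const.mul (h.comp (by fun_prop))

lemma potential_nonneg (z : ℂ) : 0 ≤ potential m B z := by
  refine mul_nonneg (by norm_num) (intervalIntegral.integral_nonneg (by positivity) fun σ _ => ?_)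
  exact gain_nonneg m B (Real.sqrt_nonneg σ)

lemma potential_le (z : ℂ) : potential m B z ≤ (1 / 2) * gain m B ‖z‖ * ‖z‖ ^ 2 := by
  have h : ∫ σ in (0 : ℝ)..‖z‖ ^ 2, gain m B (Real.sqrt σ) ≤
      ∫ _ in (0 : ℝ)..‖z‖ ^ 2, gain m B ‖z‖ := by
    refine intervalIntegral.integral_mono_on (by positivity)
      ((continuous_gain_sqrt m B).intervalIntegrable _ _) (by simp) fun σ hσ => ?_
    refine gain_mono m B (Real.sqrt_nonneg σ) ?_
    rw [← Real.sqrt_sq (norm_nonneg z)]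
    exact Real.sqrt_le_sqrt hσ.2
  rw [intervalIntegral.integral_const, sub_zero, smul_eq_mul] at h
  rw [potential]
  linarith

lemma abs_potential_sub_le (z w : ℂ) :
    |potential m B (z + w) - potential m B z - (inner ℂ (truncNL m B z) w).re| ≤
      lipNL m B * ‖w‖ ^ 2 := by
  have hin : ∀ y : ℂ, (inner ℂ (truncNL m B y) w).re = gain m B ‖y‖ * (inner ℂ y w).re := by
    intro y
    simp [truncNL, RCLike.inner_apply]
    ring
  have hpot : ∀ s : ℝ, HasDerivAt (fun s : ℝ => potential m B (z + s * w))
      (inner ℂ (truncNL m B (z + s * w)) w).re s := by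
    intro s
    have h1 : HasDerivAt (fun s : ℝ => z + s * w) w s := by
      simpa using ((Complex.ofRealCLM.hasDerivAt (x := s)).mul_const w).const_add z
    have h2 : HasDerivAt (fun s : ℝ => ‖z + s * w‖ ^ 2) (2 * (inner ℂ (z + s * w) w).re) s := by
      have h3 := h1.norm_sq
      refine h3.congr_deriv ?_
      simp [RCLike.inner_apply, Complex.inner]
    have h3 := ((continuous_gain_sqrt m B).integral_hasStrictDerivAt 0
      (‖z + s * w‖ ^ 2)).hasDerivAt
    have h4 := (h3.comp s h2).const_mul (1 / 2)
    refine h4.congr_deriv ?_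
    rw [hin, Real.sqrt_sq (norm_nonneg _)]
    ring
  have hd : ∀ s : ℝ, HasDerivAt (fun s : ℝ => potential m B (z + s * w) -
      s * (inner ℂ (truncNL m B z) w).re)
      ((inner ℂ (truncNL m B (z + s * w) - truncNL m B z) w).re) s := by
    intro s
    refine ((hpot s).sub ((hasDerivAt_id s).mul_const _)).congr_deriv ?_
    simp
    ring
  have h := norm_image_sub_le_of_norm_deriv_le_segment_01' (C := lipNL m B * ‖w‖ ^ 2)
    (fun s _ => (hd s).hasDerivWithinAt) (fun s hs => by
      refine (Complex.abs_re_le_norm _).trans ((norm_inner_le_norm _ _).trans ?_)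
      have h1 := (lipschitzWith_truncNL m B).dist_le_mul (z + s * w) z
      rw [dist_eq_norm, dist_eq_norm, add_sub_cancel_left, norm_mul, Complex.norm_real,
        Real.norm_of_nonneg hs.1] at h1
      have h2 : s * ‖w‖ ≤ 1 * ‖w‖ := by have := hs.2.le; gcongr
      calc _ ≤ (lipNL m B * (1 * ‖w‖)) * ‖w‖ := by
            gcongr
            exact h1.trans (by gcongr)
        _ = _ := by ring)
  simp only [Real.norm_eq_abs] at h
  convert h using 2
  simp
  ring

/-! ### The nonlinearity and its energy on `L²(ℝ)` -/

/-- The truncated nonlinearity, as a map of `L²(ℝ)`. -/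
def nlOp (f : L2) : L2 := (lipschitzWith_truncNL m B).compLp (truncNL_zero m B) f

lemma coeFn_nlOp (f : L2) : nlOp m B f =ᵐ[volume] fun x => truncNL m B (f x) :=
  (lipschitzWith_truncNL m B).coeFn_compLp (truncNL_zero m B) f

lemma lipschitzWith_nlOp : LipschitzWith (lipNL m B) (nlOp m B) :=
  (lipschitzWith_truncNL m B).lipschitzWith_compLp (truncNL_zero m B)

@[simp] lemma nlOp_zero : nlOp m B 0 = 0 := by
  refine Lp.ext ?_
  filter_upwards [coeFn_nlOp m B 0, Lp.coeFn_zero ℂ 2 (volume : Measure ℝ)] with x h1 h2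
  rw [h1, h2]
  exact truncNL_zero m B

/-- The potential energy `∫ Φ(f)`. -/
def potEnergy (f : L2) : ℝ := ∫ x, potential m B (f x)

lemma integrable_potential (f : L2) :
    Integrable (fun x => potential m B (f x)) (volume : Measure ℝ) := by
  refine Integrable.mono' ((integrable_norm_sq f).const_mul ((1 / 2) * (B : ℝ) ^ (2 * (m : ℝ))))
    ((continuous_potential m B).comp_aestronglyMeasurable (Lp.aestronglyMeasurable f))
    (Eventually.of_forall fun x => ?_)
  rw [Real.norm_of_nonneg (potential_nonneg m B _)]
  refine (potential_le m B _).trans ?_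
  have := gain_le m B (norm_nonneg (f x))
  gcongr

lemma potEnergy_nonneg (f : L2) : 0 ≤ potEnergy m B f :=
  integral_nonneg fun x => potential_nonneg m B (f x)

lemma potEnergy_le {f : L2} {S : ℝ} (hS : ∀ᵐ x, ‖f x‖ ≤ S) :
    potEnergy m B f ≤ (1 / 2) * S ^ (2 * (m : ℝ)) * ‖f‖ ^ 2 := by
  rw [norm_sq_eq_integral, ← integral_const_mul]
  refine integral_mono_ae (integrable_potential m B f) ((integrable_norm_sq f).const_mul _) ?_
  filter_upwards [hS] with x hx
  refine (potential_le m B _).trans ?_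
  have := gain_le_rpow m B (norm_nonneg (f x)) hx
  gcongr

lemma abs_potEnergy_sub_le (f g : L2) :
    |potEnergy m B (f + g) - potEnergy m B f - (inner ℂ (nlOp m B f) g).re| ≤
      lipNL m B * ‖g‖ ^ 2 := by
  have h1 : (inner ℂ (nlOp m B f) g).re = ∫ x, (inner ℂ (truncNL m B (f x)) (g x)).re := by
    rw [L2.inner_def]
    have := integral_re (L2.integrable_inner (𝕜 := ℂ) (nlOp m B f) g)
    simp only [RCLike.re_to_complex] at this
    rw [← this]
    refine integral_congr_ae ?_
    filter_upwards [coeFn_nlOp m B f] with x hx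
    rw [hx]
  have hi : Integrable (fun x => (inner ℂ (truncNL m B (f x)) (g x)).re) volume := by
    refine (L2.integrable_inner (𝕜 := ℂ) (nlOp m B f) g).re.congr ?_
    filter_upwards [coeFn_nlOp m B f] with x hx
    rw [hx]; rfl
  have hs : potEnergy m B (f + g) = ∫ x, potential m B (f x + g x) := by
    refine integral_congr_ae ?_
    filter_upwards [Lp.coeFn_add f g] with x hx
    rw [hx, Pi.add_apply]
  have hsi : Integrable (fun x => potential m B (f x + g x)) volume := by
    refine (integrable_potential m B (f + g)).congr ?_
    filter_upwards [Lp.coeFn_add f g] with x hx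
    rw [hx, Pi.add_apply]
  have hsub : Integrable (fun x => potential m B (f x + g x) - potential m B (f x)) volume :=
    hsi.sub (integrable_potential m B f)
  rw [hs, h1, potEnergy, ← integral_sub hsi (integrable_potential m B f),
    ← integral_sub hsub hi, norm_sq_eq_integral,
    ← integral_const_mul, ← Real.norm_eq_abs]
  refine norm_integral_le_of_norm_le ((integrable_norm_sq g).const_mul _)
    (Eventually.of_forall fun x => ?_)
  rw [Real.norm_eq_abs]
  exact abs_potential_sub_le m B (f x) (g x)

/-- The potential energy is differentiable along curves in `L²`, and the nonlinearity is its
gradient. -/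
lemma hasDerivAt_potEnergy {F : ℝ → L2} {F' : L2} {t : ℝ} (hF : HasDerivAt F F' t) :
    HasDerivAt (fun s => potEnergy m B (F s)) (inner ℂ (nlOp m B (F t)) F').re t := by
  set D : L2 →L[ℝ] ℝ :=
    Complex.reCLM.comp ((innerSL ℂ (nlOp m B (F t))).restrictScalars ℝ) with hD
  have hJ : HasFDerivAt (potEnergy m B) D (F t) := by
    rw [hasFDerivAt_iff_isLittleO_nhds_zero]
    have h1 : (fun h : L2 => potEnergy m B (F t + h) - potEnergy m B (F t) - D h) =O[𝓝 0]
        fun h => ‖h‖ ^ 2 := by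
      refine Asymptotics.IsBigO.of_bound (lipNL m B) (Eventually.of_forall fun h => ?_)
      rw [norm_pow, norm_norm]
      exact abs_potEnergy_sub_le m B (F t) h
    exact h1.trans_isLittleO (by simpa using Asymptotics.isLittleO_norm_pow_id one_lt_two)
  exact hJ.comp_hasDerivAt t hF

lemma re_inner_nlOp_I_smul (f : L2) : (inner ℂ (nlOp m B f) (Complex.I • f)).re = 0 := by
  have h1 : (inner ℂ (nlOp m B f) (Complex.I • f)).re =
      ∫ x, (inner ℂ (truncNL m B (f x)) (Complex.I * f x)).re := by
    rw [L2.inner_def]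
    have := integral_re (L2.integrable_inner (𝕜 := ℂ) (nlOp m B f) (Complex.I • f))
    simp only [RCLike.re_to_complex] at this
    rw [← this]
    refine integral_congr_ae ?_
    filter_upwards [coeFn_nlOp m B f, Lp.coeFn_smul Complex.I f] with x h1 h2
    rw [h1, h2, Pi.smul_apply, smul_eq_mul]
  rw [h1]
  refine integral_eq_zero_of_ae (Eventually.of_forall fun x => ?_)
  simp [truncNL, RCLike.inner_apply]
  ring

/-- Translation `f ↦ f(· + h)` on `L²(ℝ)`. -/
def translate (h : ℝ) : L2 →ₗᵢ[ℂ] L2 :=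
  Lp.compMeasurePreservingₗᵢ ℂ (fun x => x + h) (measurePreserving_add_right volume h)

lemma coeFn_translate (h : ℝ) (f : L2) : translate h f =ᵐ[volume] fun x => f (x + h) :=
  Lp.coeFn_compMeasurePreserving f (measurePreserving_add_right volume h)

lemma nlOp_translate (h : ℝ) (f : L2) : nlOp m B (translate h f) = translate h (nlOp m B f) := by
  refine Lp.ext ?_
  have h1 := (measurePreserving_add_right (volume : Measure ℝ) h).quasiMeasurePreserving.ae
    (coeFn_nlOp m B f)
  filter_upwards [coeFn_nlOp m B (translate h f), coeFn_translate h f,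
    coeFn_translate h (nlOp m B f), h1] with x h1 h2 h3 h4
  rw [h1, h2, h3, h4]

lemma potEnergy_translate (h : ℝ) (f : L2) : potEnergy m B (translate h f) = potEnergy m B f := by
  have h1 : potEnergy m B (translate h f) = ∫ x, potential m B (f (x + h)) := by
    refine integral_congr_ae ?_
    filter_upwards [coeFn_translate h f] with x hx
    rw [hx]
  rw [h1, integral_add_right_eq_self (fun x => potential m B (f x))]
  rfl

end

/-! ### The Fourier side -/

/-- The angular frequency `2πξ`. -/
def freq (x : ℝ) : ℝ := 2 * Real.pi * x

/-- The dispersion relation `(2πξ)²`. -/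
def disp (x : ℝ) : ℝ := freq x ^ 2

lemma measurable_freq : Measurable freq := by unfold freq; fun_prop

lemma measurable_disp : Measurable disp := by unfold disp freq; fun_prop

/-- The Fourier multiplier `1_S`. -/
def ind (S : Set ℝ) : ℝ → ℂ := S.indicator 1

lemma isMultiplier_ind {S : Set ℝ} (hS : MeasurableSet S) : IsMultiplier (ind S) := by
  refine ⟨measurable_one.indicator hS, 1, fun x => ?_⟩
  by_cases h : x ∈ S <;> simp [ind, h]

lemma norm_ind_le (S : Set ℝ) (x : ℝ) : ‖ind S x‖ ≤ 1 := by
  by_cases h : x ∈ S <;> simp [ind, h]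

lemma star_ind (S : Set ℝ) (x : ℝ) : ind S x = star (ind S x) := by
  by_cases h : x ∈ S <;> simp [ind, h]

lemma mulOp_ind_mulOp_ind {S T : Set ℝ} (hS : MeasurableSet S) (hT : MeasurableSet T)
    (hST : S ⊆ T) (f : L2) : mulOp (ind T) (mulOp (ind S) f) = mulOp (ind S) f := by
  rw [mulOp_mulOp (isMultiplier_ind hT) (isMultiplier_ind hS)]
  congr 2
  funext x
  by_cases h : x ∈ S
  · simp [ind, h, hST h]
  · simp [ind, h]

lemma norm_mulOp_ind_le {S : Set ℝ} (hS : MeasurableSet S) (f : L2) : ‖mulOp (ind S) f‖ ≤ ‖f‖ := by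
  simpa using norm_mulOp_le (isMultiplier_ind hS) (norm_ind_le S) f

lemma cutoff_eq_mulOp (f : L2) : cutoff f = mulOp (ind (Ici 0)) f := by
  symm
  rw [mulOp_eq_iff (isMultiplier_ind measurableSet_Ici)]
  have hi : MemLp ((Ici (0 : ℝ)).indicator f) 2 (volume : Measure ℝ) :=
    (Lp.memLp f).indicator measurableSet_Ici
  have : cutoff f = hi.toLp := by
    simp only [cutoff, LinearMap.coe_mk, AddHom.coe_mk]
  rw [this]
  filter_upwards [hi.coeFn_toLp] with x hx
  rw [hx]
  by_cases h : x ∈ Ici (0 : ℝ)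
  · rw [indicator_of_mem h, ind, indicator_of_mem h]; simp
  · rw [indicator_of_notMem h, ind, indicator_of_notMem h]; simp

lemma fourier_szego (f : L2) : 𝓕 (szego f) = mulOp (ind (Ici 0)) (𝓕 f) := by
  rw [← cutoff_eq_mulOp]
  exact FourierTransform.fourier_fourierInv_eq _

lemma mem_hardyL2_iff (f : L2) : f ∈ hardyL2 ↔ mulOp (ind (Ici 0)) (𝓕 f) = 𝓕 f := by
  constructor
  · rintro ⟨g, rfl⟩
    rw [fourier_szego, mulOp_ind_mulOp_ind measurableSet_Ici measurableSet_Ici subset_rfl]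
  · intro h
    refine ⟨f, ?_⟩
    have : 𝓕 (szego f) = 𝓕 f := by rw [fourier_szego, h]
    have h2 := congrArg (fun g : L2 => (𝓕⁻ g : L2)) this
    simpa only [FourierTransform.fourierInv_fourier_eq] using h2

/-- On `L²` elements, multiplication by the frequency in the sense of tempered distributions is
multiplication almost everywhere. -/
lemma mulEq_freq_iff (v w : L2) : MulEq (fun x => (freq x : ℂ)) v w ↔
    ∀ ψ : 𝓢(ℝ, ℂ), (w : 𝓢'(ℝ, ℂ)) ψ =
      (v : 𝓢'(ℝ, ℂ)) (SchwartzMap.smulLeftCLM ℂ (fun x => (freq x : ℂ)) ψ) := by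
  have ht : (fun x => (freq x : ℂ)).HasTemperateGrowth := by unfold freq; fun_prop
  simp only [Lp.toTemperedDistribution_apply, SchwartzMap.smulLeftCLM_apply_apply ht, smul_eq_mul]
  constructor
  · intro h ψ
    refine integral_congr_ae ?_
    filter_upwards [h] with x hx
    rw [hx]; ring
  · intro h
    refine ae_eq_of_integral_contDiff_smul_eq ((Lp.memLp w).locallyIntegrable (by norm_num)) ?_ ?_
    · have h1 := (Lp.memLp v).locallyIntegrable (by norm_num)
      refine (locallyIntegrable_iff).2 fun k hk => ?_
      have := IntegrableOn.continuousOn_mul (K := k) (g := fun x => (freq x : ℂ)) (g' := v)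
        (μ := volume) (by unfold freq; fun_prop) ((locallyIntegrable_iff).1 h1 k hk) hk
      exact this
    · intro g g_smooth g_cpt
      have hg₁ : HasCompactSupport (Complex.ofRealCLM ∘ g) := g_cpt.comp_left rfl
      have hg₂ : ContDiff ℝ (⊤ : ℕ∞) (Complex.ofRealCLM ∘ g) := by fun_prop
      have := h (hg₁.toSchwartzMap hg₂)
      simp only [HasCompactSupport.toSchwartzMap_toFun, Function.comp_apply,
        Complex.ofRealCLM_apply] at this
      simp only [Complex.real_smul]
      rw [this]
      refine integral_congr_ae (Eventually.of_forall fun x => ?_)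
      simp only
      ring

lemma fourier_derivCLM (T : 𝓢'(ℝ, ℂ)) : 𝓕 (TemperedDistribution.derivCLM ℂ T) =
    Complex.I • TemperedDistribution.smulLeftCLM ℂ (fun x => (freq x : ℂ)) (𝓕 T) := by
  rw [← lineDeriv_eq_deriv, TemperedDistribution.fourier_lineDerivOp_eq]
  have h1 : (fun x => (freq x : ℂ)) =
      (2 * Real.pi : ℂ) • fun x : ℝ => ((inner ℝ x 1 : ℝ) : ℂ) := by
    funext x
    simp [freq]
  rw [h1, TemperedDistribution.smulLeftCLM_smul (by fun_prop)]
  simp only [FunLike.coe_smul, Pi.smul_apply, smul_smul]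
  congr 1
  ring

/-- The weak derivative on the Fourier side. -/
lemma derivCLM_eq_iff (f g : L2) :
    TemperedDistribution.derivCLM ℂ (f : 𝓢'(ℝ, ℂ)) = (g : 𝓢'(ℝ, ℂ)) ↔
      MulEq (fun x => (freq x : ℂ)) (𝓕 f) (-Complex.I • 𝓕 g) := by
  rw [mulEq_freq_iff]
  have hinj : TemperedDistribution.derivCLM ℂ (f : 𝓢'(ℝ, ℂ)) = (g : 𝓢'(ℝ, ℂ)) ↔
      𝓕 (TemperedDistribution.derivCLM ℂ (f : 𝓢'(ℝ, ℂ))) = 𝓕 (g : 𝓢'(ℝ, ℂ)) :=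
    ⟨fun h => by rw [h], fun h => by
      have h2 := congrArg (fun T : 𝓢'(ℝ, ℂ) => (𝓕⁻ T : 𝓢'(ℝ, ℂ))) h
      simpa only [FourierTransform.fourierInv_fourier_eq] using h2⟩
  rw [hinj, fourier_derivCLM, Lp.fourier_toTemperedDistribution_eq,
    Lp.fourier_toTemperedDistribution_eq]
  have hs : ∀ ψ : 𝓢(ℝ, ℂ), ((-Complex.I • 𝓕 g : L2) : 𝓢'(ℝ, ℂ)) ψ =
      -Complex.I * ((𝓕 g : L2) : 𝓢'(ℝ, ℂ)) ψ := fun ψ => by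
    rw [← Lp.toTemperedDistributionCLM_apply, map_smul]
    rfl
  constructor
  · intro h ψ
    rw [hs, ← h]
    have h1 : ∀ z : ℂ, -Complex.I * (Complex.I * z) = z := fun z => by
      rw [← mul_assoc]; simp
    exact h1 _
  · intro h
    ext ψ
    have := h ψ
    rw [hs] at this
    rw [← TemperedDistribution.smulLeftCLM_apply_apply] at this
    have h1 : ∀ z w : ℂ, -Complex.I * z = w → Complex.I * w = z := fun z w h => by
      rw [← h, ← mul_assoc]; simp
    exact h1 _ _ this

/-! ### Translations and sup norm bounds on the Fourier side -/

lemma fourier_translate (h : ℝ) (f : L2) :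
    𝓕 (translate h f) = mulOp (phase freq h) (𝓕 f) := by
  have hq := isMultiplier_phase measurable_freq h
  refine DenseRange.induction_on
    (p := fun f : L2 => 𝓕 (translate h f) = mulOp (phase freq h) (𝓕 f))
    (SchwartzMap.denseRange_toLpCLM (E := ℝ) (F := ℂ) (p := 2) (μ := volume)
      ENNReal.ofNat_ne_top) f ?_ ?_
  · have hF : Continuous fun f : L2 => (𝓕 f : L2) :=
      (FourierTransform.fourierCLM ℂ L2).continuous
    exact isClosed_eq (hF.comp (translate h).continuous) ((mulOp _).continuous.comp hF)
  · intro φ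
    have h1 : translate h (φ.toLp 2 volume) = (φ.compSubConstCLM ℂ (-h)).toLp 2 volume := by
      refine Lp.ext ?_
      have h2 := (measurePreserving_add_right (volume : Measure ℝ) h).quasiMeasurePreserving.ae
        (φ.coeFn_toLp 2 volume)
      filter_upwards [coeFn_translate h (φ.toLp 2 volume), h2,
        (φ.compSubConstCLM ℂ (-h)).coeFn_toLp 2 volume] with x h3 h4 h5
      rw [h3, h4, h5]
      simp
    rw [SchwartzMap.toLpCLM_apply, h1, SchwartzMap.toLp_fourier_eq, SchwartzMap.toLp_fourier_eq]
    symm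
    rw [mulOp_eq_iff hq]
    filter_upwards [(𝓕 (φ.compSubConstCLM ℂ (-h))).coeFn_toLp 2 volume,
      (𝓕 φ).coeFn_toLp 2 volume] with x h3 h4
    rw [h3, h4, SchwartzMap.fourier_coe, SchwartzMap.fourier_coe]
    have h5 : ((φ.compSubConstCLM ℂ (-h) : 𝓢(ℝ, ℂ)) : ℝ → ℂ) = φ ∘ fun v => v + h := by
      funext v; simp
    have h6 := congrFun (VectorFourier.fourierIntegral_comp_add_right Real.fourierChar
      (volume : Measure ℝ) (innerₗ ℝ) (φ : ℝ → ℂ) h) x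
    rw [h5]
    refine Eq.trans h6 ?_
    rw [Circle.smul_def, smul_eq_mul]
    congr 1
    rw [Real.fourierChar_apply, phase, freq]
    congr 1
    simp
    ring

/-- The inverse Fourier transform of an integrable `v ∈ L²` is bounded by `∫ ‖v‖`. -/
lemma norm_fourierInv_le {v : L2} (hv : Integrable v (volume : Measure ℝ)) :
    ∀ᵐ x, ‖(𝓕⁻ v : L2) x‖ ≤ ∫ ξ, ‖v ξ‖ := by
  have hae : ∀ᵐ x ∂(volume : Measure ℝ), (𝓕⁻ v : L2) x = 𝓕⁻ (v : ℝ → ℂ) x := by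
    have hint : LocallyIntegrable (𝓕⁻ (v : ℝ → ℂ)) volume :=
      (VectorFourier.fourierIntegral_continuous Real.continuous_fourierChar
        (by fun_prop) hv).locallyIntegrable
    refine ae_eq_of_integral_contDiff_smul_eq
      ((Lp.memLp (𝓕⁻ v : L2)).locallyIntegrable (by norm_num)) hint fun g g_smooth g_cpt => ?_
    have hg₁ : HasCompactSupport (Complex.ofRealCLM ∘ g) := g_cpt.comp_left rfl
    have hg₂ : ContDiff ℝ (⊤ : ℕ∞) (Complex.ofRealCLM ∘ g) := by fun_prop
    set G : 𝓢(ℝ, ℂ) := hg₁.toSchwartzMap hg₂ with hG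
    have e1 : ∫ x, g x • (𝓕⁻ v : L2) x = ((𝓕⁻ v : L2) : 𝓢'(ℝ, ℂ)) G := by
      simp [G]
    have e2 : ((𝓕⁻ v : L2) : 𝓢'(ℝ, ℂ)) G = (v : 𝓢'(ℝ, ℂ)) (𝓕⁻ G) := by
      rw [← Lp.fourierInv_toTemperedDistribution_eq]
      simp
    have e3 := VectorFourier.integral_fourierIntegral_smul_eq_flip (L := -innerₗ ℝ)
      (f := (G : ℝ → ℂ)) (μ := volume) (ν := volume)
      Real.continuous_fourierChar (by fun_prop) G.integrable hv
    rw [e1, e2, Lp.toTemperedDistribution_apply, SchwartzMap.fourierInv_coe]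
    refine Eq.trans e3 (integral_congr_ae (Eventually.of_forall fun x => ?_))
    have e4 : VectorFourier.fourierIntegral Real.fourierChar volume (-innerₗ ℝ).flip v x =
        𝓕⁻ (v : ℝ → ℂ) x := by
      rw [Real.fourierInv_eq]
      simp [VectorFourier.fourierIntegral, mul_comm]
    simp only [e4]
    simp [G]
  filter_upwards [hae] with x hx
  rw [hx, Real.fourierInv_eq]
  refine (norm_integral_le_integral_norm _).trans (le_of_eq ?_)
  simp

/-- A Brezis–Gallouët type inequality on the Fourier side. With `‖v‖²` and `∫ |ξ| ‖v‖²` (the square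
of the `H^{1/2}` norm) under control, `∫ ‖v‖` grows at most like an arbitrarily small power of the
`H¹` norm. -/
lemma exists_integral_norm_le {δ : ℝ} (hδ : 0 < δ) (hδ1 : δ ≤ 1) :
    ∃ C : ℝ, 0 ≤ C ∧ ∀ v w : L2, MulEq (fun x => (freq x : ℂ)) v w →
      Integrable v (volume : Measure ℝ) ∧
      Integrable (fun x => |freq x| * ‖v x‖ ^ 2) (volume : Measure ℝ) ∧
      ∫ x, ‖v x‖ ≤ (1 + ‖w‖ ^ 2) ^ (δ / 2) *
        (C + 3 * ‖v‖ ^ 2 + ∫ x, |freq x| * ‖v x‖ ^ 2) := by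
  have hI : Integrable (fun x => (1 + |freq x|) ^ (-(1 + δ))) (volume : Measure ℝ) := by
    have h1 := integrable_one_add_norm (E := ℝ) (μ := volume) (r := 1 + δ) (by simpa using hδ)
    have h2 := h1.comp_mul_left' (R := 2 * Real.pi) (by positivity)
    simpa [freq] using h2
  refine ⟨2 + ∫ x, (1 + |freq x|) ^ (-(1 + δ)), ?_, fun v w hvw => ?_⟩
  · have : 0 ≤ ∫ x, (1 + |freq x|) ^ (-(1 + δ)) := integral_nonneg fun x => by positivity
    linarith
  set Y : ℝ := 1 + ‖w‖ ^ 2 with hY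
  have hY1 : 1 ≤ Y := by rw [hY]; nlinarith [sq_nonneg ‖w‖]
  have hY0 : 0 < Y := by linarith
  have hM := integrable_norm_sq v
  have hW : Integrable (fun x => freq x ^ 2 * ‖v x‖ ^ 2) volume := by
    refine (integrable_norm_sq w).congr ?_
    filter_upwards [hvw] with x hx
    rw [hx, norm_mul, mul_pow, Complex.norm_real, Real.norm_eq_abs, sq_abs]
  have hWi : ∫ x, freq x ^ 2 * ‖v x‖ ^ 2 = ‖w‖ ^ 2 := by
    rw [norm_sq_eq_integral]
    refine integral_congr_ae ?_
    filter_upwards [hvw] with x hx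
    rw [hx, norm_mul, mul_pow, Complex.norm_real, Real.norm_eq_abs, sq_abs]
  have hP : Integrable (fun x => |freq x| * ‖v x‖ ^ 2) volume := by
    refine Integrable.mono' (hM.add hW) ?_ (Eventually.of_forall fun x => ?_)
    · exact (measurable_freq.abs.aestronglyMeasurable).mul hM.aestronglyMeasurable
    · rw [Real.norm_of_nonneg (by positivity), Pi.add_apply]
      nlinarith [sq_nonneg (|freq x| - 1), sq_abs (freq x), sq_nonneg ‖v x‖,
        mul_nonneg (sq_nonneg (|freq x| - 1)) (sq_nonneg ‖v x‖), mul_nonneg (abs_nonneg (freq x))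
        (sq_nonneg ‖v x‖)]
  -- the weight `1 + |ξ| + (1 + |ξ|)² / Y` balances the two norms
  set R : ℝ → ℝ := fun x => (1 + |freq x|) ^ (-(1 + δ)) +
    (‖v x‖ ^ 2 + |freq x| * ‖v x‖ ^ 2 +
      2 / Y * (‖v x‖ ^ 2 + freq x ^ 2 * ‖v x‖ ^ 2)) with hR
  have hRi : Integrable R volume :=
    hI.add ((hM.add hP).add ((hM.add hW).const_mul _))
  have hle : ∀ x, ‖v x‖ ≤ Y ^ (δ / 2) * R x := by
    intro x
    set X : ℝ := 1 + |freq x| with hX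
    have hX1 : 1 ≤ X := by rw [hX]; linarith [abs_nonneg (freq x)]
    have hX0 : 0 < X := by linarith
    have hXY : (X / Y) ^ δ ≤ 1 + X / Y := by
      have h0 : 0 ≤ X / Y := by positivity
      calc (X / Y) ^ δ ≤ (1 + X / Y) ^ δ := by gcongr; linarith
        _ ≤ (1 + X / Y) ^ (1 : ℝ) := by
            apply Real.rpow_le_rpow_of_exponent_le _ hδ1; linarith
        _ = _ := Real.rpow_one _
    have hXδ : X ^ (1 + δ) ≤ Y ^ δ * (X + X ^ 2 / Y) := by
      rw [Real.rpow_add hX0, Real.rpow_one]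
      rw [Real.div_rpow hX0.le hY0.le, div_le_iff₀ (by positivity)] at hXY
      calc X * X ^ δ ≤ X * ((1 + X / Y) * Y ^ δ) := by gcongr
        _ = _ := by field_simp
    have hX2 : X ^ 2 ≤ 2 * (1 + freq x ^ 2) := by
      rw [hX]; nlinarith [sq_nonneg (|freq x| - 1), sq_abs (freq x)]
    set s : ℝ := Y ^ (δ / 2) with hs
    have hs0 : 0 < s := by positivity
    have hs2 : s ^ 2 = Y ^ δ := by
      rw [hs, ← Real.rpow_natCast, ← Real.rpow_mul hY0.le]; congr 1; push_cast; ring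
    have hA : X ^ (-(1 + δ)) * X ^ (1 + δ) = 1 := by
      rw [← Real.rpow_add hX0]; simp
    have hA0 : 0 < X ^ (-(1 + δ)) := by positivity
    have hB0 : 0 < X ^ (1 + δ) := by positivity
    set a := X ^ (-(1 + δ)) with ha
    set b := X ^ (1 + δ) with hb
    set n := ‖v x‖ with hn
    have hn0 : 0 ≤ n := norm_nonneg _
    -- the inequality of arithmetic and geometric means
    have h1 : n ≤ s * (a + n ^ 2 * (b / s ^ 2)) := by
      have h2 : 0 ≤ a * (s - b * n) ^ 2 := by positivity
      have h3 : a * (s - b * n) ^ 2 = a * s ^ 2 - 2 * s * n * (a * b) + (a * b) * b * n ^ 2 := by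
        ring
      rw [h3, hA] at h2
      have h4 : s * (a + n ^ 2 * (b / s ^ 2)) = (a * s ^ 2 + b * n ^ 2) / s := by
        field_simp
      rw [h4, le_div_iff₀ hs0]
      nlinarith [mul_nonneg hn0 hs0.le]
    refine h1.trans ?_
    rw [hR]
    dsimp only
    gcongr
    have h5 : b / s ^ 2 ≤ X + X ^ 2 / Y := by
      rw [hs2, div_le_iff₀ (by positivity), mul_comm]
      exact hXδ
    have h6 : X ^ 2 / Y ≤ 2 / Y * (1 + freq x ^ 2) := by
      rw [div_mul_eq_mul_div]; gcongr
    calc n ^ 2 * (b / s ^ 2) ≤ n ^ 2 * (X + 2 / Y * (1 + freq x ^ 2)) := by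
          gcongr; linarith
      _ = _ := by rw [hX]; ring
  have hvi : Integrable v (volume : Measure ℝ) :=
    Integrable.mono' (hRi.const_mul _) (Lp.aestronglyMeasurable v) (Eventually.of_forall hle)
  refine ⟨hvi, hP, ?_⟩
  refine (integral_mono hvi.norm (hRi.const_mul _) hle).trans ?_
  rw [integral_const_mul]
  gcongr
  have hRint : ∫ x, R x = (∫ x, (1 + |freq x|) ^ (-(1 + δ))) + (‖v‖ ^ 2 +
      (∫ x, |freq x| * ‖v x‖ ^ 2) + 2 / Y * (‖v‖ ^ 2 + ‖w‖ ^ 2)) := by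
    have h1 : Integrable (fun x => ‖v x‖ ^ 2 + |freq x| * ‖v x‖ ^ 2) volume := hM.add hP
    have h2 : Integrable (fun x => ‖v x‖ ^ 2 + freq x ^ 2 * ‖v x‖ ^ 2) volume := hM.add hW
    have h3 : Integrable (fun x => ‖v x‖ ^ 2 + |freq x| * ‖v x‖ ^ 2 +
        2 / Y * (‖v x‖ ^ 2 + freq x ^ 2 * ‖v x‖ ^ 2)) volume := h1.add (h2.const_mul _)
    simp only [hR]
    rw [integral_add hI h3, integral_add h1 (h2.const_mul _), integral_add hM hP,
      integral_const_mul, integral_add hM hW, hWi, norm_sq_eq_integral v]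
  rw [hRint]
  have h7 : 2 / Y * (‖v‖ ^ 2 + ‖w‖ ^ 2) ≤ 2 * ‖v‖ ^ 2 + 2 := by
    rw [div_mul_eq_mul_div, div_le_iff₀ hY0, hY]
    nlinarith [sq_nonneg ‖v‖, sq_nonneg ‖w‖, mul_nonneg (sq_nonneg ‖v‖) (sq_nonneg ‖w‖)]
  linarith

/-! ### The nonlinearity on the Fourier side -/

section


variable (m B : ℝ≥0)

/-- The truncated nonlinearity, conjugated by the Fourier transform. -/
def fnl (v : L2) : L2 := 𝓕 (nlOp m B (𝓕⁻ v))

/-- The potential energy, as a function of the Fourier transform. -/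
def fpot (v : L2) : ℝ := potEnergy m B (𝓕⁻ v)

lemma fourier_sub' (f g : L2) : 𝓕 (f - g) = 𝓕 f - 𝓕 g :=
  map_sub (Lp.fourierTransformₗᵢ ℝ ℂ) f g

lemma fourierInv_sub' (f g : L2) : 𝓕⁻ (f - g) = 𝓕⁻ f - 𝓕⁻ g :=
  map_sub (Lp.fourierTransformₗᵢ ℝ ℂ).symm f g

lemma norm_fourierInv (f : L2) : ‖(𝓕⁻ f : L2)‖ = ‖f‖ :=
  (Lp.fourierTransformₗᵢ ℝ ℂ).symm.norm_map f

lemma inner_fourier_left (f v : L2) : inner ℂ (𝓕 f) v = inner ℂ f (𝓕⁻ v) := by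
  rw [← Lp.inner_fourier_eq f, FourierTransform.fourier_fourierInv_eq]

lemma lipschitzWith_fnl : LipschitzWith (lipNL m B) (fnl m B) := by
  refine LipschitzWith.of_dist_le_mul fun v w => ?_
  have h := (lipschitzWith_nlOp m B).dist_le_mul (𝓕⁻ v) (𝓕⁻ w)
  rw [dist_eq_norm, dist_eq_norm, ← fourierInv_sub', norm_fourierInv] at h
  rw [dist_eq_norm, dist_eq_norm, fnl, fnl, ← fourier_sub', Lp.norm_fourier_eq]
  exact h

@[simp] lemma fnl_zero : fnl m B 0 = 0 := by
  have h : (𝓕⁻ (0 : L2) : L2) = 0 := map_zero (Lp.fourierTransformₗᵢ ℝ ℂ).symm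
  have h' : (𝓕 (0 : L2) : L2) = 0 := map_zero (Lp.fourierTransformₗᵢ ℝ ℂ)
  rw [fnl, h, nlOp_zero, h']

lemma fourierInv_mulOp_phase (h : ℝ) (v : L2) :
    𝓕⁻ (mulOp (phase freq h) v) = translate h (𝓕⁻ v) := by
  have := fourier_translate h (𝓕⁻ v)
  rw [FourierTransform.fourier_fourierInv_eq] at this
  rw [← this, FourierTransform.fourierInv_fourier_eq]

lemma fnl_mulOp_phase (h : ℝ) (v : L2) :
    fnl m B (mulOp (phase freq h) v) = mulOp (phase freq h) (fnl m B v) := by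
  rw [fnl, fourierInv_mulOp_phase, nlOp_translate, fourier_translate, fnl]

lemma fpot_mulOp_phase (h : ℝ) (v : L2) : fpot m B (mulOp (phase freq h) v) = fpot m B v := by
  rw [fpot, fourierInv_mulOp_phase, potEnergy_translate, fpot]

lemma hasDerivAt_fpot {F : ℝ → L2} {F' : L2} {t : ℝ} (hF : HasDerivAt F F' t) :
    HasDerivAt (fun s => fpot m B (F s)) (inner ℂ (fnl m B (F t)) F').re t := by
  have h : HasDerivAt (fun s => (𝓕⁻ (F s) : L2)) (𝓕⁻ F') t :=
    ((FourierTransform.fourierInvCLM ℂ L2).restrictScalars ℝ).hasFDerivAt.comp_hasDerivAt t hF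
  have h1 := hasDerivAt_potEnergy m B h
  rw [fnl, inner_fourier_left]
  exact h1

lemma fpot_nonneg (v : L2) : 0 ≤ fpot m B v := potEnergy_nonneg m B _

lemma fpot_le {v : L2} {S : ℝ} (hv : Integrable v (volume : Measure ℝ)) (hS : ∫ x, ‖v x‖ ≤ S) :
    fpot m B v ≤ (1 / 2) * S ^ (2 * (m : ℝ)) * ‖v‖ ^ 2 := by
  have := potEnergy_le m B (f := 𝓕⁻ v) (S := S) (by
    filter_upwards [norm_fourierInv_le hv] with x hx
    exact hx.trans hS)
  rwa [norm_fourierInv] at this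

/-- Phase invariance of the energy, which yields the conservation of mass. -/
lemma re_inner_fnl_I_smul (v : L2) : (inner ℂ (fnl m B v) (Complex.I • v)).re = 0 := by
  rw [fnl, inner_fourier_left, FourierTransform.fourierInv_smul]
  exact re_inner_nlOp_I_smul m B _

/-- Translation invariance of the energy, which yields the conservation of momentum. -/
lemma re_inner_fnl_I_smul_freq {v w : L2} (hvw : MulEq (fun x => (freq x : ℂ)) v w) :
    (inner ℂ (fnl m B v) (Complex.I • w)).re = 0 := by
  have hvw' : MulEq (fun x => Complex.I * freq x) v (Complex.I • w) := by
    unfold MulEq at *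
    filter_upwards [hvw, Lp.coeFn_smul Complex.I w] with x h1 h2
    rw [h2, Pi.smul_apply, h1, smul_eq_mul, mul_assoc]
  have h1 := hasDerivAt_fpot m B (hasDerivAt_mulOp_phase measurable_freq hvw' 0)
  simp only [fpot_mulOp_phase, mulOp_phase_zero] at h1
  exact h1.unique (hasDerivAt_const _ _)

/-- The nonlinearity preserves `H¹`: being Lipschitz on `L²` and equivariant under translations, it
does not increase the difference quotients by more than its Lipschitz constant. -/
lemma exists_mulEq_freq_fnl {v w : L2} (hvw : MulEq (fun x => (freq x : ℂ)) v w) :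
    ∃ z : L2, MulEq (fun x => (freq x : ℂ)) (fnl m B v) z ∧ ‖z‖ ≤ lipNL m B * ‖w‖ := by
  have hmul : ∀ h : ℝ, IsMultiplier (fun x => (h : ℂ)⁻¹ * (phase freq h x - 1)) := by
    intro h
    refine ⟨?_, ‖(h : ℂ)⁻¹‖ * 2, fun x => ?_⟩
    · have := (isMultiplier_phase measurable_freq h).measurable
      fun_prop
    · rw [norm_mul]
      gcongr
      refine (norm_sub_le _ _).trans ?_
      rw [norm_phase, norm_one]; norm_num
  have hquot : ∀ (h : ℝ) (f : L2), mulOp (fun x => (h : ℂ)⁻¹ * (phase freq h x - 1)) f =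
      (h : ℂ)⁻¹ • (mulOp (phase freq h) f - f) := by
    intro h f
    rw [mulOp_eq_iff (hmul h)]
    filter_upwards [Lp.coeFn_smul (h : ℂ)⁻¹ (mulOp (phase freq h) f - f),
      Lp.coeFn_sub (mulOp (phase freq h) f) f,
      coeFn_mulOp (isMultiplier_phase measurable_freq h) f] with x h1 h2 h3
    rw [h1, Pi.smul_apply, h2, Pi.sub_apply, h3, smul_eq_mul]
    ring
  obtain ⟨g, hg, hgn⟩ := exists_mulEq_of_tendsto (l := 𝓝[≠] (0 : ℝ)) (f := fnl m B v)
    (K := lipNL m B * ‖w‖) hmul (b := fun x => Complex.I * freq x)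
    (by have := measurable_freq; fun_prop)
    (fun x => by
      have := (hasDerivAt_phase freq x 0).tendsto_slope_zero
      simpa using this)
    (by
      filter_upwards [self_mem_nhdsWithin] with h hh
      have h0 : 0 < ‖(h : ℂ)‖ := by simpa using hh
      have h1 := (lipschitzWith_fnl m B).dist_le_mul (mulOp (phase freq h) v) v
      rw [dist_eq_norm, dist_eq_norm, fnl_mulOp_phase] at h1
      have h2 : ‖mulOp (phase freq h) v - v‖ ≤ ‖(h : ℂ)‖ * ‖w‖ := by
        refine norm_le_of_ae_le ?_
        filter_upwards [Lp.coeFn_sub (mulOp (phase freq h) v) v,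
          coeFn_mulOp (isMultiplier_phase measurable_freq h) v, hvw] with x h2 h3 h4
        rw [h2, Pi.sub_apply, h3, h4, ← sub_one_mul, norm_mul, norm_mul, Complex.norm_real,
          Complex.norm_real, ← mul_assoc]
        gcongr
        exact norm_phase_sub_one_le freq h x
      rw [hquot, norm_smul, norm_inv, inv_mul_le_iff₀ h0]
      calc _ ≤ _ := h1
        _ ≤ lipNL m B * (‖(h : ℂ)‖ * ‖w‖) := by gcongr
        _ = _ := by ring)
  refine ⟨-Complex.I • g, ?_, by simpa [norm_smul] using hgn⟩
  unfold MulEq at *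
  filter_upwards [hg, Lp.coeFn_smul (-Complex.I) g] with x h1 h2
  rw [h2, Pi.smul_apply, h1, smul_eq_mul, ← mul_assoc, ← mul_assoc]
  simp

end

/-! ### The equation in the interaction picture -/

section


variable (m B : ℝ≥0) (lam : ℝ)

/-- The vector field of the equation in the interaction picture. If `u` solves the (truncated)
equation, `V(t) = e^{it(2πξ)²} 𝓕 u(t)` solves `V' = field V`; the set `S` is `[0, ∞)` for the Szegő
projector, or `[0, n]` for the band limited approximation. -/
def field (S : Set ℝ) (t : ℝ) (V : L2) : L2 :=
  (-Complex.I * lam) • mulOp (ind S) (mulOp (phase disp t) (fnl m B (mulOp (phase disp (-t)) V)))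

variable {m B lam}

lemma norm_neg_I_mul (hlam : |lam| = 1) : ‖-Complex.I * (lam : ℂ)‖ = 1 := by
  simp [hlam]

lemma lipschitzWith_field (hlam : |lam| = 1) {S : Set ℝ} (hS : MeasurableSet S) (t : ℝ) :
    LipschitzWith (lipNL m B) (field m B lam S t) := by
  refine LipschitzWith.of_dist_le_mul fun V W => ?_
  rw [dist_eq_norm, dist_eq_norm, field, field, ← smul_sub, ← map_sub, ← map_sub, norm_smul,
    norm_neg_I_mul hlam, one_mul]
  refine (norm_mulOp_ind_le hS _).trans ?_
  rw [norm_mulOp_phase measurable_disp]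
  have := (lipschitzWith_fnl m B).dist_le_mul (mulOp (phase disp (-t)) V)
    (mulOp (phase disp (-t)) W)
  rwa [dist_eq_norm, dist_eq_norm, ← map_sub, norm_mulOp_phase measurable_disp] at this

lemma continuous_field (S : Set ℝ) : Continuous (Function.uncurry (field m B lam S)) := by
  have h1 : Continuous fun p : ℝ × L2 => mulOp (phase disp (-p.1)) p.2 :=
    continuous_mulOp_phase_comp measurable_disp (by fun_prop) (by fun_prop)
  have h2 : Continuous fun p : ℝ × L2 =>
      mulOp (phase disp p.1) (fnl m B (mulOp (phase disp (-p.1)) p.2)) :=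
    continuous_mulOp_phase_comp measurable_disp (by fun_prop)
      ((lipschitzWith_fnl m B).continuous.comp h1)
  exact ((mulOp (ind S)).continuous.comp h2).const_smul (-Complex.I * (lam : ℂ))

lemma continuous_field_comp (S : Set ℝ) {V : ℝ → L2} (hV : Continuous V) :
    Continuous fun s => field m B lam S s (V s) :=
  Continuous.comp (g := Function.uncurry (field m B lam S)) (f := fun s => (s, V s))
    (continuous_field S) (continuous_id.prodMk hV)

lemma field_zero (S : Set ℝ) (t : ℝ) : field m B lam S t 0 = 0 := by simp [field]

lemma exists_flow (hlam : |lam| = 1) {S : Set ℝ} (hS : MeasurableSet S) (V₀ : L2) :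
    ∃ V : ℝ → L2, V 0 = V₀ ∧ ∀ t, HasDerivAt V (field m B lam S t (V t)) t :=
  exists_global_integralCurve (lipschitzWith_field hlam hS) (continuous_field S) (field_zero S) V₀

lemma mulOp_ind_field {S T : Set ℝ} (hS : MeasurableSet S) (hT : MeasurableSet T) (hST : S ⊆ T)
    (t : ℝ) (V : L2) : mulOp (ind T) (field m B lam S t V) = field m B lam S t V := by
  rw [field, map_smul, mulOp_ind_mulOp_ind hS hT hST]

/-- Integral curves stay in the range of the projector. -/
lemma mulOp_ind_flow {S : Set ℝ} (hS : MeasurableSet S) {V : ℝ → L2}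
    (hV : ∀ t, HasDerivAt V (field m B lam S t (V t)) t) (h0 : mulOp (ind S) (V 0) = V 0) (t : ℝ) :
    mulOp (ind S) (V t) = V t := by
  have h1 : ∀ t, HasDerivAt (fun t => mulOp (ind S) (V t) - V t) 0 t := fun t => by
    have h2 := ((mulOp (ind S)).restrictScalars ℝ).hasFDerivAt.comp_hasDerivAt t (hV t)
    refine (h2.sub (hV t)).congr_deriv ?_
    rw [ContinuousLinearMap.coe_restrictScalars', mulOp_ind_field hS hS subset_rfl, sub_self]
  have h2 := is_const_of_deriv_eq_zero (fun t => (h1 t).differentiableAt)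
    (fun t => (h1 t).deriv) t 0
  simp only [h0, sub_self] at h2
  exact sub_eq_zero.1 h2

lemma inner_field_left {S : Set ℝ} (hS : MeasurableSet S) (t : ℝ) (V a : L2) :
    (inner ℂ (field m B lam S t V) a).re =
      lam * (inner ℂ (fnl m B (mulOp (phase disp (-t)) V))
        (Complex.I • mulOp (phase disp (-t)) (mulOp (ind S) a))).re := by
  rw [field, inner_smul_left, inner_mulOp (isMultiplier_ind hS) (isMultiplier_ind hS) (star_ind S),
    inner_mulOp_phase measurable_disp, inner_smul_right]
  simp

/-! ### Conservation laws of the band limited equation -/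

/-- The band limited frequency multiplier. -/
def bandFreq (n : ℕ) (x : ℝ) : ℂ := freq x * ind (Icc 0 (n : ℝ)) x

lemma norm_bandFreq_le (n : ℕ) (x : ℝ) : ‖bandFreq n x‖ ≤ 2 * Real.pi * n := by
  by_cases h : x ∈ Icc 0 (n : ℝ)
  · simp only [bandFreq, ind, indicator_of_mem h, Pi.one_apply, mul_one, Complex.norm_real, freq,
      norm_mul, Real.norm_eq_abs, abs_of_nonneg h.1, abs_of_pos Real.pi_pos, abs_two]
    have := Real.pi_pos
    gcongr
    exact h.2
  · simp only [bandFreq, ind, indicator_of_notMem h, mul_zero, norm_zero]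
    positivity

lemma isMultiplier_bandFreq (n : ℕ) : IsMultiplier (bandFreq n) :=
  ⟨((by have := measurable_freq; fun_prop : Measurable fun x => (freq x : ℂ))).mul
    (isMultiplier_ind measurableSet_Icc).measurable, _, norm_bandFreq_le n⟩

lemma star_bandFreq (n : ℕ) (x : ℝ) : bandFreq n x = star (bandFreq n x) := by
  rw [bandFreq, star_mul, ← star_ind]
  simp [mul_comm]

lemma mulEq_freq_bandFreq {n : ℕ} {v : L2} (hv : mulOp (ind (Icc 0 (n : ℝ))) v = v) :
    MulEq (fun x => (freq x : ℂ)) v (mulOp (bandFreq n) v) := by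
  unfold MulEq
  filter_upwards [coeFn_mulOp (isMultiplier_bandFreq n) v,
    (mulOp_eq_iff (isMultiplier_ind measurableSet_Icc)).1 hv] with x h1 h2
  rw [h1, bandFreq, mul_assoc, ← h2]

lemma mulOp_bandFreq_eq_of_mulEq {n : ℕ} {v w : L2} (hvw : MulEq (fun x => (freq x : ℂ)) v w) :
    mulOp (bandFreq n) v = mulOp (ind (Icc 0 (n : ℝ))) w := by
  rw [mulOp_eq_iff (isMultiplier_bandFreq n)]
  filter_upwards [coeFn_mulOp (isMultiplier_ind (measurableSet_Icc (a := 0) (b := (n : ℝ)))) w, hvw]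
    with x h1 h2
  rw [h1, h2, bandFreq]
  ring

lemma re_inner_comm (f g : L2) : (inner ℂ f g).re = (inner ℂ g f).re := by
  rw [← inner_conj_symm, Complex.conj_re]

lemma hasDerivAt_re_inner {F G : ℝ → L2} {F' G' : L2} {t : ℝ} (hF : HasDerivAt F F' t)
    (hG : HasDerivAt G G' t) :
    HasDerivAt (fun s => (inner ℂ (F s) (G s)).re)
      ((inner ℂ (F t) G').re + (inner ℂ F' (G t)).re) t := by
  have := Complex.reCLM.hasFDerivAt.comp_hasDerivAt t (hF.inner ℂ hG)
  exact this

section BandLimited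

variable {n : ℕ} {V : ℝ → L2}

lemma hasDerivAt_mulOp_comp (a : ℝ → ℂ) {F : ℝ → L2} {F' : L2} {t : ℝ} (hF : HasDerivAt F F' t) :
    HasDerivAt (fun s => mulOp a (F s)) (mulOp a F') t :=
  ((mulOp a).restrictScalars ℝ).hasFDerivAt.comp_hasDerivAt t hF

lemma const_of_hasDerivAt_zero {f : ℝ → ℝ} (hf : ∀ t, HasDerivAt f 0 t) (t : ℝ) : f t = f 0 :=
  is_const_of_deriv_eq_zero (fun t => (hf t).differentiableAt) (fun t => (hf t).deriv) t 0

lemma band_mulOp_phase (hs : ∀ t, mulOp (ind (Icc 0 (n : ℝ))) (V t) = V t) (t r : ℝ) :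
    mulOp (ind (Icc 0 (n : ℝ))) (mulOp (phase disp r) (V t)) = mulOp (phase disp r) (V t) := by
  rw [mulOp_comm (isMultiplier_ind measurableSet_Icc) (isMultiplier_phase measurable_disp r), hs]

/-- Conservation of mass. -/
lemma norm_band_eq
    (hV : ∀ t, HasDerivAt V (field m B lam (Icc 0 (n : ℝ)) t (V t)) t)
    (hs : ∀ t, mulOp (ind (Icc 0 (n : ℝ))) (V t) = V t) (t : ℝ) :
    ‖V t‖ = ‖V 0‖ := by
  have h : ∀ t, HasDerivAt (fun s => (inner ℂ (V s) (V s)).re) 0 t := fun t => by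
    refine (hasDerivAt_re_inner (hV t) (hV t)).congr_deriv ?_
    rw [re_inner_comm (V t), inner_field_left measurableSet_Icc, hs, re_inner_fnl_I_smul]
    simp
  have h1 := const_of_hasDerivAt_zero h t
  have h2 : ∀ f : L2, (inner ℂ f f).re = ‖f‖ ^ 2 := fun f => inner_self_eq_norm_sq (𝕜 := ℂ) f
  rw [h2, h2] at h1
  exact (pow_left_inj₀ (norm_nonneg _) (norm_nonneg _) two_ne_zero).1 h1

/-- Conservation of momentum. -/
lemma momentum_band_eq
    (hV : ∀ t, HasDerivAt V (field m B lam (Icc 0 (n : ℝ)) t (V t)) t)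
    (hs : ∀ t, mulOp (ind (Icc 0 (n : ℝ))) (V t) = V t) (t : ℝ) :
    (inner ℂ (V t) (mulOp (bandFreq n) (V t))).re =
    (inner ℂ (V 0) (mulOp (bandFreq n) (V 0))).re := by
  have hA := isMultiplier_bandFreq n
  refine const_of_hasDerivAt_zero (f := fun t => (inner ℂ (V t) (mulOp (bandFreq n) (V t))).re)
    (fun t => ?_) t
  refine (hasDerivAt_re_inner (hV t) (hasDerivAt_mulOp_comp (bandFreq n) (hV t))).congr_deriv ?_
  rw [← inner_mulOp hA hA (star_bandFreq n), re_inner_comm (mulOp (bandFreq n) (V t)),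
    inner_field_left measurableSet_Icc,
    mulOp_comm (isMultiplier_ind measurableSet_Icc) hA, hs,
    ← mulOp_comm hA (isMultiplier_phase measurable_disp _),
    re_inner_fnl_I_smul_freq m B (mulEq_freq_bandFreq (band_mulOp_phase hs t (-t)))]
  simp

/-- Conservation of energy. -/
lemma energy_band_eq
    (hV : ∀ t, HasDerivAt V (field m B lam (Icc 0 (n : ℝ)) t (V t)) t)
    (hs : ∀ t, mulOp (ind (Icc 0 (n : ℝ))) (V t) = V t) (t : ℝ) :
    (1 / 2) * ‖mulOp (bandFreq n) (V t)‖ ^ 2 + lam * fpot m B (mulOp (phase disp (-t)) (V t)) =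
      (1 / 2) * ‖mulOp (bandFreq n) (V 0)‖ ^ 2 + lam * fpot m B (V 0) := by
  have hA := isMultiplier_bandFreq n
  have hI := isMultiplier_ind (measurableSet_Icc (a := 0) (b := (n : ℝ)))
  have hn : ∀ f : L2, ‖f‖ ^ 2 = (inner ℂ f f).re := fun f =>
    (inner_self_eq_norm_sq (𝕜 := ℂ) f).symm
  have h : ∀ t, HasDerivAt (fun t => (1 / 2) * (inner ℂ (mulOp (bandFreq n) (V t))
      (mulOp (bandFreq n) (V t))).re + lam * fpot m B (mulOp (phase disp (-1 * t)) (V t))) 0 t := by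
    intro t
    set v := mulOp (phase disp (-t)) (V t) with hv
    have h1 := hasDerivAt_mulOp_comp (bandFreq n) (hV t)
    have hg : MulEq (fun x => Complex.I * disp x) (V t)
        (Complex.I • mulOp (bandFreq n) (mulOp (bandFreq n) (V t))) := by
      have h2 := mulEq_freq_bandFreq (hs t)
      have h3 := mulEq_freq_bandFreq (v := mulOp (bandFreq n) (V t)) (n := n)
        (by rw [mulOp_comm hI hA, hs])
      unfold MulEq at *
      filter_upwards [h2, h3, Lp.coeFn_smul Complex.I
        (mulOp (bandFreq n) (mulOp (bandFreq n) (V t)))] with x h4 h5 h6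
      rw [h6, Pi.smul_apply, h5, h4, disp, smul_eq_mul]
      push_cast
      ring
    have h2 := hasDerivAt_fpot m B ((hV t).mulOp_phase measurable_disp (c := -1) hg)
    refine (((hasDerivAt_re_inner h1 h1).const_mul (1 / 2)).add (h2.const_mul lam)).congr_deriv ?_
    rw [re_inner_comm (mulOp (bandFreq n) (V t)), inner_mulOp hA hA (star_bandFreq n),
      inner_field_left measurableSet_Icc, mulOp_comm hI hA, mulOp_comm hI hA, hs, neg_one_mul,
      ← hv, inner_add_right, Complex.add_re, neg_one_smul, inner_neg_right, map_smul]
    -- the nonlinear contribution `Re ⟨N, -iλ 1_S N⟩` vanishes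
    have h3 : (inner ℂ (fnl m B v)
        (mulOp (phase disp (-t)) (field m B lam (Icc 0 (n : ℝ)) t (V t)))).re = 0 := by
      have h4 : mulOp (phase disp (-t)) (field m B lam (Icc 0 (n : ℝ)) t (V t)) =
          (-Complex.I * lam) • mulOp (ind (Icc 0 (n : ℝ))) (fnl m B v) := by
        rw [field, map_smul, mulOp_comm (isMultiplier_phase measurable_disp _) hI,
          mulOp_phase_mulOp_phase measurable_disp, neg_add_cancel, mulOp_phase_zero]
      rw [h4, ← mulOp_ind_mulOp_ind measurableSet_Icc measurableSet_Icc subset_rfl,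
        inner_smul_right, ← inner_mulOp hI hI (star_ind _), inner_self_eq_norm_sq_to_K]
      simp [← Complex.ofReal_pow]
    rw [h3, Complex.neg_re]
    ring
  have h1 := const_of_hasDerivAt_zero h t
  simp only [← hn] at h1
  simpa using h1

end BandLimited

end

/-! ### Uniform `H¹` bounds for the band limited solutions -/

section


variable {m B : ℝ≥0} {lam : ℝ}

/-- On nonnegative frequencies the momentum is the square of the homogeneous `H^{1/2}` norm. -/
lemma momentum_eq_integral {n : ℕ} {v : L2} (hv : mulOp (ind (Icc 0 (n : ℝ))) v = v) :
    (inner ℂ v (mulOp (bandFreq n) v)).re = ∫ x, |freq x| * ‖v x‖ ^ 2 := by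
  rw [L2.inner_def]
  have h := integral_re (L2.integrable_inner (𝕜 := ℂ) v (mulOp (bandFreq n) v))
  simp only [RCLike.re_to_complex] at h
  rw [← h]
  refine integral_congr_ae ?_
  filter_upwards [mulEq_freq_bandFreq hv,
    (mulOp_eq_iff (isMultiplier_ind measurableSet_Icc)).1 hv] with x h1 h2
  rw [h1, RCLike.inner_apply, mul_assoc, Complex.mul_conj, ← Complex.ofReal_mul, Complex.ofReal_re,
    Complex.normSq_eq_norm_sq]
  by_cases hx : x ∈ Icc 0 (n : ℝ)
  · have : 0 ≤ freq x := by have := hx.1; have := Real.pi_pos; unfold freq; positivity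
    rw [abs_of_nonneg this]
  · rw [ind, indicator_of_notMem hx, zero_mul] at h2
    rw [h2]; simp

lemma norm_mulOp_ind_apply_le {S : Set ℝ} (hS : MeasurableSet S) (v : L2) :
    ∀ᵐ x, ‖mulOp (ind S) v x‖ ≤ ‖v x‖ := by
  filter_upwards [coeFn_mulOp (isMultiplier_ind hS) v] with x hx
  rw [hx, norm_mul]
  exact mul_le_of_le_one_left (norm_nonneg _) (norm_ind_le S x)

lemma le_of_sq_le_affine {a b D : ℝ} (ha : 0 ≤ a) (h : D ^ 2 ≤ a + b * (1 + D)) :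
    D ≤ 1 + 2 * a + 2 * b ^ 2 := by
  have h1 : D ^ 2 ≤ 1 + 2 * a + 2 * b ^ 2 := by
    nlinarith [sq_nonneg (b - D), sq_nonneg (b - 1)]
  rcases le_total D 1 with hD | hD
  · linarith [sq_nonneg b]
  · nlinarith

/-- The exponent `δ = 1 / (2m + 1)` is chosen so that the potential energy is at most linear in the
`H¹` norm `D`. -/
lemma fpot_le_of_subcritical {v : L2} {D Q M : ℝ} (hv : Integrable v (volume : Measure ℝ))
    (hQ : 0 ≤ Q) (hM : ‖v‖ ≤ M) (hD : 0 ≤ D)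
    (hS : ∫ x, ‖v x‖ ≤ (1 + D ^ 2) ^ (1 / (2 * (m : ℝ) + 1) / 2) * Q) :
    fpot m B v ≤ (1 / 2) * (Q ^ (2 * (m : ℝ)) * M ^ 2) * (1 + D) := by
  have hm : (0 : ℝ) ≤ m := m.2
  have hY0 : (0 : ℝ) < 1 + D ^ 2 := by positivity
  refine (fpot_le m B hv hS).trans ?_
  have h1 : ((1 + D ^ 2) ^ (1 / (2 * (m : ℝ) + 1) / 2) * Q) ^ (2 * (m : ℝ)) ≤
      (1 + D) * Q ^ (2 * (m : ℝ)) := by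
    rw [Real.mul_rpow (by positivity) hQ, ← Real.rpow_mul hY0.le]
    gcongr
    calc (1 + D ^ 2) ^ (1 / (2 * (m : ℝ) + 1) / 2 * (2 * (m : ℝ))) ≤
          (1 + D ^ 2) ^ (1 / 2 : ℝ) := by
          apply Real.rpow_le_rpow_of_exponent_le
          · linarith [sq_nonneg D]
          · field_simp
            linarith
      _ = Real.sqrt (1 + D ^ 2) := (Real.sqrt_eq_rpow _).symm
      _ ≤ 1 + D := by
          rw [Real.sqrt_le_left (by positivity)]
          linarith
  calc (1 / 2) * ((1 + D ^ 2) ^ (1 / (2 * (m : ℝ) + 1) / 2) * Q) ^ (2 * (m : ℝ)) * ‖v‖ ^ 2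
      ≤ (1 / 2) * ((1 + D) * Q ^ (2 * (m : ℝ))) * M ^ 2 := by gcongr
    _ = _ := by ring

/-- The a priori bound: mass, momentum and energy control the `H¹` norm of the band limited
solutions, uniformly in the band, in the truncation `B`, in time and in the sign. The momentum makes
the potential energy of lower order than the kinetic energy, whatever `m` is. -/
theorem exists_uniform_bound (m : ℝ≥0) {v₀ w₀ : L2} (hvw : MulEq (fun x => (freq x : ℂ)) v₀ w₀) :
    ∃ K : ℝ, 0 ≤ K ∧ ∀ (B : ℝ≥0) (lam : ℝ), |lam| = 1 → ∀ (n : ℕ) (V : ℝ → L2),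
      (∀ t, HasDerivAt V (field m B lam (Icc 0 (n : ℝ)) t (V t)) t) →
      (∀ t, mulOp (ind (Icc 0 (n : ℝ))) (V t) = V t) →
      V 0 = mulOp (ind (Icc 0 (n : ℝ))) v₀ → ∀ t, ‖mulOp (bandFreq n) (V t)‖ ≤ K := by
  set δ : ℝ := 1 / (2 * m + 1) with hδ
  have hm : (0 : ℝ) ≤ m := m.2
  have hδ0 : 0 < δ := by positivity
  have hδ1 : δ ≤ 1 := by rw [hδ, div_le_one (by positivity)]; linarith
  obtain ⟨C, hC0, hC⟩ := exists_integral_norm_le hδ0 hδ1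
  obtain ⟨hv₀i, hP₀i, -⟩ := hC v₀ w₀ hvw
  set P₀ : ℝ := ∫ x, |freq x| * ‖v₀ x‖ ^ 2 with hP₀
  have hP₀0 : 0 ≤ P₀ := integral_nonneg fun x => by positivity
  set S₀ : ℝ := ∫ x, ‖v₀ x‖ with hS₀
  have hS₀0 : 0 ≤ S₀ := integral_nonneg fun x => norm_nonneg _
  set Q : ℝ := C + 3 * ‖v₀‖ ^ 2 + P₀ with hQ
  have hQ0 : 0 ≤ Q := by positivity
  set b : ℝ := Q ^ (2 * (m : ℝ)) * ‖v₀‖ ^ 2 with hb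
  have hb0 : 0 ≤ b := by positivity
  set a : ℝ := ‖w₀‖ ^ 2 + S₀ ^ (2 * (m : ℝ)) * ‖v₀‖ ^ 2 with ha
  have ha0 : 0 ≤ a := by positivity
  refine ⟨1 + 2 * a + 2 * b ^ 2, by positivity, fun B lam hlam n V hV hs h0 t => ?_⟩
  have hI := isMultiplier_ind (measurableSet_Icc (a := 0) (b := (n : ℝ)))
  have hA := isMultiplier_bandFreq n
  have hlam' : -1 ≤ lam ∧ lam ≤ 1 := abs_le.1 hlam.le
  -- cutting off frequencies only decreases the norms of the data
  have hn0 : ‖V 0‖ ≤ ‖v₀‖ := by rw [h0]; exact norm_mulOp_ind_le measurableSet_Icc v₀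
  have hw0 : ‖mulOp (bandFreq n) (V 0)‖ ≤ ‖w₀‖ := by
    rw [h0, mulOp_comm hA hI, mulOp_bandFreq_eq_of_mulEq hvw]
    exact (norm_mulOp_ind_le measurableSet_Icc _).trans (norm_mulOp_ind_le measurableSet_Icc _)
  have hae := norm_mulOp_ind_apply_le (measurableSet_Icc (a := 0) (b := (n : ℝ))) v₀
  obtain ⟨hV0i, hPV0i, -⟩ := hC (V 0) _ (mulEq_freq_bandFreq (hs 0))
  have hP0 : ∫ x, |freq x| * ‖V 0 x‖ ^ 2 ≤ P₀ := by
    refine integral_mono_ae hPV0i hP₀i ?_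
    rw [h0]
    filter_upwards [hae] with x hx
    gcongr
  have hS0 : ∫ x, ‖V 0 x‖ ≤ S₀ := by
    refine integral_mono_ae hV0i.norm hv₀i.norm ?_
    rw [h0]
    exact hae
  have hf0 : fpot m B (V 0) ≤ (1 / 2) * S₀ ^ (2 * (m : ℝ)) * ‖v₀‖ ^ 2 := by
    refine (fpot_le m B hV0i hS0).trans ?_
    gcongr
  -- mass and momentum carry the bounds to time `t`
  set v := mulOp (phase disp (-t)) (V t) with hv
  have hsv := band_mulOp_phase hs t (-t)
  rw [← hv] at hsv
  have hAv : mulOp (bandFreq n) v = mulOp (phase disp (-t)) (mulOp (bandFreq n) (V t)) := by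
    rw [hv, mulOp_comm hA (isMultiplier_phase measurable_disp _)]
  have hnw : ‖mulOp (bandFreq n) v‖ = ‖mulOp (bandFreq n) (V t)‖ := by
    rw [hAv, norm_mulOp_phase measurable_disp]
  have hnv : ‖v‖ ≤ ‖v₀‖ := by
    rw [hv, norm_mulOp_phase measurable_disp, norm_band_eq hV hs]; exact hn0
  have hPv : ∫ x, |freq x| * ‖v x‖ ^ 2 ≤ P₀ := by
    have h1 : (inner ℂ v (mulOp (bandFreq n) v)).re =
        (inner ℂ (V t) (mulOp (bandFreq n) (V t))).re := by
      rw [hAv, hv, inner_mulOp_phase measurable_disp, mulOp_phase_mulOp_phase measurable_disp,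
        neg_neg, add_neg_cancel, mulOp_phase_zero]
    rw [← momentum_eq_integral hsv, h1, momentum_band_eq hV hs, momentum_eq_integral (hs 0)]
    exact hP0
  obtain ⟨hvi, -, hvS⟩ := hC v _ (mulEq_freq_bandFreq hsv)
  rw [hnw] at hvS
  set D := ‖mulOp (bandFreq n) (V t)‖ with hD
  have hY0 : (0 : ℝ) < 1 + D ^ 2 := by positivity
  have hft : fpot m B v ≤ (1 / 2) * b * (1 + D) := by
    refine fpot_le_of_subcritical hvi hQ0 hnv (norm_nonneg _) (hvS.trans ?_)
    rw [hQ]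
    gcongr
  -- the energy is quadratic in `D`, up to a potential energy which is linear in `D`
  have hE := energy_band_eq hV hs t
  rw [← hv, ← hD] at hE
  have h1 := fpot_nonneg m B v
  have h2 := fpot_nonneg m B (V 0)
  have hw0' : ‖mulOp (bandFreq n) (V 0)‖ ^ 2 ≤ ‖w₀‖ ^ 2 := by gcongr
  have hD0 : 0 ≤ D := norm_nonneg _
  have h3 : D ^ 2 ≤ a + b * (1 + D) := by
    have h4 : lam * fpot m B (V 0) ≤ fpot m B (V 0) := by nlinarith
    have h5 : -(lam * fpot m B v) ≤ fpot m B v := by nlinarith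
    rw [ha]
    linarith
  exact le_of_sq_le_affine ha0 h3

/-! ### Passage to the limit -/

lemma exists_mulEq_freq_of_norm_le {f : L2} {K : ℝ} (hf : mulOp (ind (Ici 0)) f = f)
    (hK : ∀ n : ℕ, ‖mulOp (bandFreq n) f‖ ≤ K) :
    ∃ g : L2, MulEq (fun x => (freq x : ℂ)) f g ∧ ‖g‖ ≤ K := by
  obtain ⟨g, hg, hgK⟩ := exists_mulEq_of_tendsto (l := atTop) (a := bandFreq)
    (b := fun x => freq x * ind (Ici 0) x) isMultiplier_bandFreq
    ((by have := measurable_freq; fun_prop : Measurable fun x => (freq x : ℂ)).mul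
      (isMultiplier_ind measurableSet_Ici).measurable)
    (fun x => by
      obtain ⟨N, hN⟩ := exists_nat_ge x
      refine tendsto_const_nhds.congr' ?_
      filter_upwards [eventually_ge_atTop N] with n hn
      have hxn : x ≤ n := hN.trans (by exact_mod_cast hn)
      have : x ∈ Ici (0 : ℝ) ↔ x ∈ Icc 0 (n : ℝ) := by simp [hxn]
      by_cases hx : x ∈ Ici (0 : ℝ)
      · simp only [bandFreq, ind, indicator_of_mem hx, indicator_of_mem (this.1 hx)]
      · simp only [bandFreq, ind, indicator_of_notMem hx, indicator_of_notMem (mt this.2 hx)])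
    (Eventually.of_forall hK)
  refine ⟨g, ?_, hgK⟩
  unfold MulEq at *
  filter_upwards [hg, (mulOp_eq_iff (isMultiplier_ind measurableSet_Ici)).1 hf] with x h1 h2
  rw [h1, mul_assoc, ← h2]

/-- Frequencies above `n` are small in `L²` for functions of `H¹`. -/
lemma norm_sub_mulOp_ind_le {f g : L2} (hfg : MulEq (fun x => (freq x : ℂ)) f g) {n : ℕ}
    (hn : 0 < n) :
    ‖mulOp (ind (Ici 0)) f - mulOp (ind (Icc 0 (n : ℝ))) f‖ ≤ (n : ℝ)⁻¹ * ‖g‖ := by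
  refine norm_le_of_ae_le ?_
  filter_upwards [Lp.coeFn_sub (mulOp (ind (Ici 0)) f) (mulOp (ind (Icc 0 (n : ℝ))) f),
    coeFn_mulOp (isMultiplier_ind measurableSet_Ici) f,
    coeFn_mulOp (isMultiplier_ind (measurableSet_Icc (a := 0) (b := (n : ℝ)))) f, hfg]
    with x h1 h2 h3 h4
  rw [h1, Pi.sub_apply, h2, h3, h4, ← sub_mul, norm_mul, norm_mul, ← mul_assoc]
  gcongr
  have hn' : (0 : ℝ) < n := by exact_mod_cast hn
  by_cases hx : x ∈ Ici (0 : ℝ)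
  · by_cases hx' : x ∈ Icc 0 (n : ℝ)
    · simp only [ind, indicator_of_mem hx, indicator_of_mem hx', sub_self, norm_zero]
      positivity
    · have hxn : (n : ℝ) < x := by
        by_contra h
        exact hx' ⟨hx, not_lt.1 h⟩
      simp only [ind, indicator_of_mem hx, indicator_of_notMem hx', sub_zero, Pi.one_apply,
        norm_one, Complex.norm_real, freq]
      rw [Real.norm_of_nonneg (by have := Real.pi_pos; have : (0 : ℝ) ≤ x := hx; positivity),
        le_inv_mul_iff₀ hn']
      have := Real.two_le_pi
      nlinarith
  · have hx' : x ∉ Icc 0 (n : ℝ) := fun h => hx h.1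
    simp only [ind, indicator_of_notMem hx, indicator_of_notMem hx', sub_self, norm_zero]
    positivity

lemma gronwallBound_mul (c δ K ε x : ℝ) :
    gronwallBound (c * δ) K (c * ε) x = c * gronwallBound δ K ε x := by
  unfold gronwallBound
  split_ifs <;> ring

lemma mulEq_phase_fnl {V W : L2} (hVW : MulEq (fun x => (freq x : ℂ)) V W) (t : ℝ) :
    ∃ z : L2, MulEq (fun x => (freq x : ℂ))
      (mulOp (phase disp t) (fnl m B (mulOp (phase disp (-t)) V))) z ∧
      ‖z‖ ≤ lipNL m B * ‖W‖ := by
  obtain ⟨z, hz, hzn⟩ := exists_mulEq_freq_fnl m B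
    (hVW.mulOp (isMultiplier_phase measurable_disp (-t)))
  refine ⟨mulOp (phase disp t) z, hz.mulOp (isMultiplier_phase measurable_disp t), ?_⟩
  rwa [norm_mulOp_phase measurable_disp] at hzn ⊢

/-- The band limited solutions converge to the solution of the full (truncated) equation, which
inherits their `H¹` bound. -/
theorem exists_bound_flow (m : ℝ≥0) {v₀ w₀ : L2} (hvw : MulEq (fun x => (freq x : ℂ)) v₀ w₀)
    (h₀ : mulOp (ind (Ici 0)) v₀ = v₀) :
    ∃ K : ℝ, 0 ≤ K ∧ ∀ (B : ℝ≥0) (lam : ℝ), |lam| = 1 → ∀ V : ℝ → L2, V 0 = v₀ →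
      (∀ t, HasDerivAt V (field m B lam (Ici 0) t (V t)) t) → ∀ t, ‖V t‖ ≤ ‖v₀‖ ∧
      ∃ W : L2, MulEq (fun x => (freq x : ℂ)) (V t) W ∧ ‖W‖ ≤ K := by
  obtain ⟨K, hK0, hK⟩ := exists_uniform_bound m hvw
  refine ⟨K, hK0, fun B lam hlam V hV0 hV t => ?_⟩
  have hVs : mulOp (ind (Ici 0)) (V t) = V t :=
    mulOp_ind_flow measurableSet_Ici hV (by rw [hV0, h₀]) t
  choose X hX0 hX using fun n : ℕ => exists_flow (m := m) (B := B) hlam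
    (measurableSet_Icc (a := 0) (b := (n : ℝ))) (mulOp (ind (Icc 0 (n : ℝ))) v₀)
  have hXs : ∀ (n : ℕ) t, mulOp (ind (Icc 0 (n : ℝ))) (X n t) = X n t := fun n =>
    mulOp_ind_flow measurableSet_Icc (hX n)
      (by rw [hX0, mulOp_ind_mulOp_ind measurableSet_Icc measurableSet_Icc subset_rfl])
  have hXK : ∀ (n : ℕ) t, ‖mulOp (bandFreq n) (X n t)‖ ≤ K := fun n =>
    hK B lam hlam n (X n) (hX n) (hXs n) (hX0 n)
  have hlim : Tendsto (fun n => X n t) atTop (𝓝 (V t)) := by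
    rw [tendsto_iff_dist_tendsto_zero]
    have h1 : Tendsto (fun n : ℕ => (n : ℝ)⁻¹ *
        gronwallBound ‖w₀‖ (lipNL m B) (lipNL m B * K) |t|) atTop (𝓝 0) := by
      simpa using tendsto_inv_atTop_nhds_zero_nat.mul_const
        (gronwallBound ‖w₀‖ (lipNL m B) (lipNL m B * K) |t|)
    refine squeeze_zero' (Eventually.of_forall fun n => dist_nonneg) ?_ h1
    filter_upwards [eventually_gt_atTop 0] with n hn
    rw [dist_comm, ← gronwallBound_mul]
    refine dist_le_gronwallBound_abs (lipschitzWith_field hlam measurableSet_Ici) hV (hX n)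
      (fun s => ?_) ?_ t
    · obtain ⟨z, hz, hzn⟩ := mulEq_phase_fnl (m := m) (B := B) (mulEq_freq_bandFreq (hXs n s)) s
      rw [dist_comm, dist_eq_norm, field, field, ← smul_sub, norm_smul, norm_neg_I_mul hlam,
        one_mul]
      refine (norm_sub_mulOp_ind_le hz hn).trans ?_
      have := hXK n s
      gcongr
      exact hzn.trans (by gcongr)
    · rw [hV0, hX0, dist_eq_norm]
      nth_rw 1 [← h₀]
      exact norm_sub_mulOp_ind_le hvw hn
  refine ⟨?_, exists_mulEq_freq_of_norm_le hVs fun R => ?_⟩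
  · refine le_of_tendsto hlim.norm (Eventually.of_forall fun n => ?_)
    rw [norm_band_eq (hX n) (hXs n), hX0]
    exact norm_mulOp_ind_le measurableSet_Icc _
  · refine le_of_tendsto (((mulOp (bandFreq R)).continuous.tendsto _).comp hlim).norm
      (Eventually.of_forall fun n => ?_)
    simp only [Function.comp_apply]
    rw [mulOp_bandFreq_eq_of_mulEq (mulEq_freq_bandFreq (hXs n t))]
    exact (norm_mulOp_ind_le measurableSet_Icc _).trans (hXK n t)

/-- A solution of the interaction equation which is bounded in `H¹` is Lipschitz in time with values
in `H¹`, because its time derivative contains no derivative in space. -/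
lemma continuous_freq_flow (hlam : |lam| = 1) {V W : ℝ → L2} {K : ℝ}
    (hV : ∀ t, HasDerivAt V (field m B lam (Ici 0) t (V t)) t)
    (hVs : ∀ t, mulOp (ind (Ici 0)) (V t) = V t)
    (hVW : ∀ t, MulEq (fun x => (freq x : ℂ)) (V t) (W t)) (hW : ∀ t, ‖W t‖ ≤ K) :
    Continuous W := by
  have hK0 : 0 ≤ K := (norm_nonneg _).trans (hW 0)
  have hder : ∀ (n : ℕ) t, ‖mulOp (bandFreq n) (field m B lam (Ici 0) t (V t))‖ ≤
      lipNL m B * K := by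
    intro n t
    obtain ⟨z, hz, hzn⟩ := mulEq_phase_fnl (m := m) (B := B) (hVW t) t
    rw [field, map_smul, norm_smul, norm_neg_I_mul hlam, one_mul,
      mulOp_comm (isMultiplier_bandFreq n) (isMultiplier_ind measurableSet_Ici),
      mulOp_bandFreq_eq_of_mulEq hz]
    refine (norm_mulOp_ind_le measurableSet_Ici _).trans
      ((norm_mulOp_ind_le measurableSet_Icc _).trans (hzn.trans ?_))
    have := hW t
    gcongr
  have hlip : LipschitzWith (lipNL m B * K.toNNReal) W := by
    refine LipschitzWith.of_dist_le_mul fun t s => ?_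
    obtain ⟨g, hg, hgn⟩ := exists_mulEq_freq_of_norm_le (f := V t - V s)
      (K := lipNL m B * K * ‖t - s‖) (by rw [map_sub, hVs, hVs]) (fun n => by
        rw [map_sub]
        exact Convex.norm_image_sub_le_of_norm_hasDerivWithin_le (s := univ)
          (f := fun t => mulOp (bandFreq n) (V t))
          (fun r _ => (hasDerivAt_mulOp_comp (bandFreq n) (hV r)).hasDerivWithinAt)
          (fun r _ => hder n r) convex_univ (mem_univ _) (mem_univ _))
    rw [dist_eq_norm, ((hVW t).sub (hVW s)).unique hg]
    refine hgn.trans (le_of_eq ?_)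
    rw [NNReal.coe_mul, Real.coe_toNNReal _ hK0, dist_eq_norm]
  exact hlip.continuous

end

/-! ### `H¹₊` on the Fourier side -/

section


/-- The Fourier transform of the function underlying an element of `H¹₊`. -/
def hat (f : H1Plus) : L2 := 𝓕 (toL2 f)

/-- `2πξ` times the Fourier transform of the function underlying an element of `H¹₊`. -/
def freqHat (f : H1Plus) : L2 := -Complex.I • 𝓕 (f : WithLp 2 (L2 × L2)).snd

lemma mulEq_hat (f : H1Plus) : MulEq (fun x => (freq x : ℂ)) (hat f) (freqHat f) :=
  (derivCLM_eq_iff _ _).1 f.2.2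

lemma mulOp_ind_hat (f : H1Plus) : mulOp (ind (Ici 0)) (hat f) = hat f :=
  (mem_hardyL2_iff _).1 f.2.1

lemma hat_injective : Function.Injective hat := by
  intro f g hfg
  have h1 : freqHat f = freqHat g := (mulEq_hat f).unique (by rw [hfg]; exact mulEq_hat g)
  have hinj : Function.Injective fun f : L2 => (𝓕 f : L2) :=
    (Lp.fourierTransformₗᵢ ℝ ℂ).injective
  have h2 : (f : WithLp 2 (L2 × L2)).snd = (g : WithLp 2 (L2 × L2)).snd := by
    refine hinj ?_
    exact smul_right_injective L2 (neg_ne_zero.2 Complex.I_ne_zero) h1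
  have h3 : (f : WithLp 2 (L2 × L2)).fst = (g : WithLp 2 (L2 × L2)).fst := hinj hfg
  exact Subtype.ext (WithLp.ofLp_injective 2 (Prod.ext h3 h2))

lemma norm_hat_le (f : H1Plus) : ‖hat f‖ ≤ ‖f‖ := by
  rw [hat, Lp.norm_fourier_eq]
  exact WithLp.norm_fst_le (p := 2) _ (f : WithLp 2 (L2 × L2))

lemma norm_freqHat_le (f : H1Plus) : ‖freqHat f‖ ≤ ‖f‖ := by
  rw [freqHat, norm_smul, Lp.norm_fourier_eq]
  simpa using WithLp.norm_snd_le (p := 2) _ (f : WithLp 2 (L2 × L2))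

lemma continuous_hat : Continuous hat := by
  have h1 : Continuous fun f : H1Plus => (f : WithLp 2 (L2 × L2)).fst := by fun_prop
  exact (Lp.fourierTransformₗᵢ ℝ ℂ).continuous.comp h1

/-- The element of `H¹₊` with Fourier transform `v`. -/
def ofHat (v w : L2) (hvw : MulEq (fun x => (freq x : ℂ)) v w)
    (hv : mulOp (ind (Ici 0)) v = v) : H1Plus :=
  ⟨WithLp.toLp 2 (𝓕⁻ v, 𝓕⁻ (Complex.I • w)), by
    refine ⟨(mem_hardyL2_iff _).2 ?_, (derivCLM_eq_iff _ _).2 ?_⟩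
    · simpa using hv
    · simpa [smul_smul] using hvw⟩

lemma hat_ofHat {v w : L2} (hvw : MulEq (fun x => (freq x : ℂ)) v w)
    (hv : mulOp (ind (Ici 0)) v = v) : hat (ofHat v w hvw hv) = v :=
  FourierTransform.fourier_fourierInv_eq v

/-- Sobolev's inequality: a bound of the `H¹` norm bounds the supremum norm. -/
lemma exists_sup_bound (K : ℝ) : ∃ B : ℝ≥0, ∀ v w : L2, MulEq (fun x => (freq x : ℂ)) v w →
    ‖v‖ ≤ K → ‖w‖ ≤ K → ∀ᵐ x, ‖(𝓕⁻ v : L2) x‖ ≤ B := by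
  obtain ⟨C, hC0, hC⟩ := exists_integral_norm_le (δ := 1) one_pos le_rfl
  refine ⟨((1 + K ^ 2) ^ (1 / 2 : ℝ) * (C + 3 * K ^ 2 + (K ^ 2 + K ^ 2))).toNNReal,
    fun v w hvw hv hw => ?_⟩
  obtain ⟨hvi, hP, h⟩ := hC v w hvw
  have h1 : ∫ x, |freq x| * ‖v x‖ ^ 2 ≤ ‖v‖ ^ 2 + ‖w‖ ^ 2 := by
    rw [norm_sq_eq_integral v, norm_sq_eq_integral w,
      ← integral_add (integrable_norm_sq v) (integrable_norm_sq w)]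
    refine integral_mono_ae hP ((integrable_norm_sq v).add (integrable_norm_sq w)) ?_
    filter_upwards [hvw] with x hx
    rw [hx, norm_mul, Complex.norm_real, Real.norm_eq_abs]
    nlinarith [sq_nonneg (‖v x‖ - |freq x| * ‖v x‖), sq_nonneg (‖v x‖ + |freq x| * ‖v x‖)]
  have hK0 : 0 ≤ K := (norm_nonneg _).trans hv
  filter_upwards [norm_fourierInv_le hvi] with x hx
  refine (hx.trans h).trans (le_trans ?_ (Real.le_coe_toNNReal _))
  have h2 : ‖v‖ ^ 2 ≤ K ^ 2 := by gcongr
  have h3 : ‖w‖ ^ 2 ≤ K ^ 2 := by gcongr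
  gcongr
  linarith

lemma nlOp_eq_power (m B : ℝ≥0) (f : H1Plus) (h : ∀ᵐ x, ‖toL2 f x‖ ≤ B) :
    nlOp m B (toL2 f) = power m f := by
  refine Lp.ext ?_
  filter_upwards [coeFn_nlOp m B (toL2 f), (memLp_power m f).coeFn_toLp, h] with x h1 h2 h3
  rw [h1, power, h2, truncNL, gain, min_eq_left h3]

/-- The truncation is invisible to functions bounded by `B`. -/
lemma fourier_szego_power (m B : ℝ≥0) (f : H1Plus) (h : ∀ᵐ x, ‖toL2 f x‖ ≤ B) :
    𝓕 (szego (power m f)) = mulOp (ind (Ici 0)) (fnl m B (hat f)) := by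
  rw [fourier_szego, ← nlOp_eq_power m B f h, fnl, hat, FourierTransform.fourierInv_fourier_eq]

/-! ### The weak formulation on the Fourier side -/

/-- The complex conjugate of a Schwartz function, in `L²`: the `L²` inner product with `conjS ψ` is
the distributional pairing with `ψ`. -/
def conjS (ψ : 𝓢(ℝ, ℂ)) : L2 :=
  (SchwartzMap.postcompCLM (Complex.conjCLE : ℂ →L[ℝ] ℂ) ψ).toLp 2 volume

lemma coeFn_conjS (ψ : 𝓢(ℝ, ℂ)) : conjS ψ =ᵐ[volume] fun x => star (ψ x) :=
  (SchwartzMap.postcompCLM (Complex.conjCLE : ℂ →L[ℝ] ℂ) ψ).coeFn_toLp 2 volume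

lemma inner_conjS (ψ : 𝓢(ℝ, ℂ)) (f : L2) : inner ℂ (conjS ψ) f = (f : 𝓢'(ℝ, ℂ)) ψ := by
  rw [L2.inner_def, Lp.toTemperedDistribution_apply]
  refine integral_congr_ae ?_
  filter_upwards [coeFn_conjS ψ] with x hx
  rw [hx]
  simp [RCLike.inner_apply, mul_comm]

lemma hasTemperateGrowth_freq : (fun x => (freq x : ℂ)).HasTemperateGrowth := by
  unfold freq; fun_prop

/-- Multiplication of a Schwartz function by `(2πξ)²`. -/
def dispS (ψ : 𝓢(ℝ, ℂ)) : 𝓢(ℝ, ℂ) :=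
  SchwartzMap.smulLeftCLM ℂ (fun x => (freq x : ℂ))
    (SchwartzMap.smulLeftCLM ℂ (fun x => (freq x : ℂ)) ψ)

lemma dispS_apply (ψ : 𝓢(ℝ, ℂ)) (x : ℝ) : dispS ψ x = disp x * ψ x := by
  simp only [dispS, SchwartzMap.smulLeftCLM_apply_apply hasTemperateGrowth_freq, disp, smul_eq_mul]
  push_cast
  ring

lemma mulEq_disp_conjS (ψ : 𝓢(ℝ, ℂ)) : MulEq (fun x => (disp x : ℂ)) (conjS ψ)
    (conjS (dispS ψ)) := by
  unfold MulEq
  filter_upwards [coeFn_conjS ψ, coeFn_conjS (dispS ψ)] with x h1 h2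
  rw [h1, h2, dispS_apply]
  simp

lemma apply_eq_inner (f : L2) (φ : 𝓢(ℝ, ℂ)) :
    (f : 𝓢'(ℝ, ℂ)) φ = inner ℂ (conjS (𝓕⁻ φ)) (𝓕 f) := by
  rw [inner_conjS, ← Lp.fourier_toTemperedDistribution_eq]
  simp

lemma derivCLM_derivCLM_apply (f : L2) (φ : 𝓢(ℝ, ℂ)) :
    TemperedDistribution.derivCLM ℂ (TemperedDistribution.derivCLM ℂ (f : 𝓢'(ℝ, ℂ))) φ =
      -inner ℂ (conjS (dispS (𝓕⁻ φ))) (𝓕 f) := by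
  set T := TemperedDistribution.derivCLM ℂ (TemperedDistribution.derivCLM ℂ (f : 𝓢'(ℝ, ℂ))) with hT
  have h1 : T φ = 𝓕 T (𝓕⁻ φ) := by simp
  rw [h1, hT, fourier_derivCLM, fourier_derivCLM, Lp.fourier_toTemperedDistribution_eq, map_smul,
    smul_smul, Complex.I_mul_I, inner_conjS]
  have h2 : ∀ S : 𝓢'(ℝ, ℂ), ((-1 : ℂ) • S) (𝓕⁻ φ) = -(S (𝓕⁻ φ)) := fun S => by
    change (-1 : ℂ) * S (𝓕⁻ φ) = _
    rw [neg_one_mul]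
  rw [h2]
  rfl

/-- The weak equation, tested on the Fourier side. -/
lemma isSolution_iff (m : ℝ≥0) (lam : ℝ) (u : C(ℝ, H1Plus)) :
    IsSolution m lam u ↔ ∀ (ψ : 𝓢(ℝ, ℂ)) (t : ℝ), ∃ d : ℂ,
      HasDerivAt (fun s => inner ℂ (conjS ψ) (hat (u s))) d t ∧
      Complex.I * d - inner ℂ (conjS (dispS ψ)) (hat (u t)) =
        lam * inner ℂ (conjS ψ) (𝓕 (szego (power m (u t)))) := by
  simp only [IsSolution, apply_eq_inner, derivCLM_derivCLM_apply, ← sub_eq_add_neg]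
  constructor
  · intro h ψ
    have := h (𝓕 ψ)
    simp only [FourierTransform.fourierInv_fourier_eq] at this
    exact this
  · intro h φ
    exact h (𝓕⁻ φ)

/-! ### From the interaction picture to the weak equation, and back -/

variable {m B : ℝ≥0} {lam : ℝ}

lemma MulEq.const_smul {a : ℝ → ℂ} (c : ℂ) {f g : L2} (h : MulEq a f g) :
    MulEq (fun x => c * a x) f (c • g) := by
  unfold MulEq at *
  filter_upwards [h, Lp.coeFn_smul c g] with x h1 h2
  rw [h2, Pi.smul_apply, h1, smul_eq_mul, mul_assoc]

lemma mulOp_phase_neg_field (S : Set ℝ) (hS : MeasurableSet S) (t : ℝ) (V : L2) :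
    mulOp (phase disp (-t)) (field m B lam S t V) =
      (-Complex.I * lam) • mulOp (ind S) (fnl m B (mulOp (phase disp (-t)) V)) := by
  rw [field, map_smul, mulOp_comm (isMultiplier_phase measurable_disp _) (isMultiplier_ind hS),
    mulOp_phase_mulOp_phase measurable_disp, neg_add_cancel, mulOp_phase_zero]

lemma hasDerivAt_inner_flow {V : ℝ → L2} {t : ℝ}
    (hV : HasDerivAt V (field m B lam (Ici 0) t (V t)) t) {a b : L2}
    (hab : MulEq (fun x => (disp x : ℂ)) a b) :
    ∃ d : ℂ, HasDerivAt (fun s => inner ℂ a (mulOp (phase disp (-s)) (V s))) d t ∧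
      Complex.I * d - inner ℂ b (mulOp (phase disp (-t)) (V t)) =
        lam * inner ℂ a (mulOp (ind (Ici 0)) (fnl m B (mulOp (phase disp (-t)) (V t)))) := by
  have h1 := (hasDerivAt_mulOp_phase measurable_disp (hab.const_smul Complex.I) t).inner ℂ hV
  simp only [inner_mulOp_phase measurable_disp, mulOp_phase_neg_field _ measurableSet_Ici] at h1
  refine ⟨_, h1, ?_⟩
  rw [inner_smul_right, inner_smul_left]
  simp only [Complex.conj_I]
  linear_combination (-(lam : ℂ) * inner ℂ a (mulOp (ind (Ici 0))
    (fnl m B (mulOp (phase disp (-t)) (V t)))) -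
    inner ℂ b (mulOp (phase disp (-t)) (V t))) * Complex.I_mul_I

/-- Product rule for a differentiable and a merely weakly differentiable curve. -/
lemma hasDerivAt_inner_of_weak {A v : ℝ → L2} {A' : L2} {d : ℂ} {s : ℝ} (hA : HasDerivAt A A' s)
    (hv : ContinuousAt v s) (hd : HasDerivAt (fun r => inner ℂ (A s) (v r)) d s) :
    HasDerivAt (fun r => inner ℂ (A r) (v r)) (inner ℂ A' (v s) + d) s := by
  have h1 : HasDerivAt (fun r => inner ℂ (A r - A s) (v r)) (inner ℂ A' (v s)) s := by
    rw [hasDerivAt_iff_tendsto_slope_zero] at hA ⊢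
    have h2 : Tendsto (fun h : ℝ => v (s + h)) (𝓝[≠] 0) (𝓝 (v s)) := by
      have h3 : ContinuousAt (fun h : ℝ => v (s + h)) 0 :=
        ContinuousAt.comp (f := fun h : ℝ => s + h) (by simpa using hv) (by fun_prop)
      simpa [ContinuousAt] using h3.tendsto.mono_left nhdsWithin_le_nhds
    refine (hA.inner h2).congr fun h => ?_
    rw [inner_smul_left_eq_smul]
    simp
  have h2 := h1.add hd
  refine h2.congr_of_eventuallyEq (Eventually.of_forall fun r => ?_)
  simp [inner_sub_left]

end

section

variable {m B : ℝ≥0} {lam : ℝ}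

lemma contDiff_phase_disp (s : ℝ) : ContDiff ℝ (⊤ : ℕ∞) (phase disp s) := by
  have h1 : ContDiff ℝ (⊤ : ℕ∞) fun x : ℝ => s * disp x := by unfold disp freq; fun_prop
  have h2 : ContDiff ℝ (⊤ : ℕ∞) fun x : ℝ => ((s * disp x : ℝ) : ℂ) * Complex.I :=
    (Complex.ofRealCLM.contDiff.comp h1).mul contDiff_const
  exact h2.cexp

/-- Multiplication by the phase `e^{is(2πξ)²}` maps test functions to Schwartz functions. -/
lemma exists_conjS_eq_phase {ψ : 𝓢(ℝ, ℂ)} (hψ : HasCompactSupport ψ) (s : ℝ) :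
    ∃ χ : 𝓢(ℝ, ℂ), conjS χ = mulOp (phase disp (-s)) (conjS ψ) := by
  have h1 : HasCompactSupport fun x => phase disp s x * ψ x := hψ.mul_left
  have h2 : ContDiff ℝ (⊤ : ℕ∞) fun x => phase disp s x * ψ x :=
    (contDiff_phase_disp s).mul (ψ.smooth ⊤)
  refine ⟨h1.toSchwartzMap h2, ?_⟩
  symm
  rw [mulOp_eq_iff (isMultiplier_phase measurable_disp _)]
  filter_upwards [coeFn_conjS ψ, coeFn_conjS (h1.toSchwartzMap h2)] with x h3 h4
  rw [h3, h4, HasCompactSupport.toSchwartzMap_toFun, star_mul, star_phase, mul_comm]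

/-- Test functions separate the points of `L²`. -/
lemma eq_zero_of_inner_conjS {f : L2}
    (h : ∀ ψ : 𝓢(ℝ, ℂ), HasCompactSupport ψ → inner ℂ (conjS ψ) f = 0) : f = 0 := by
  rw [Lp.eq_zero_iff_ae_eq_zero]
  refine ae_eq_zero_of_integral_contDiff_smul_eq_zero
    ((Lp.memLp f).locallyIntegrable (by norm_num)) fun g g_smooth g_cpt => ?_
  have hg₁ : HasCompactSupport (Complex.ofRealCLM ∘ g) := g_cpt.comp_left rfl
  have hg₂ : ContDiff ℝ (⊤ : ℕ∞) (Complex.ofRealCLM ∘ g) := by fun_prop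
  have h1 := h (hg₁.toSchwartzMap hg₂) hg₁
  rw [inner_conjS] at h1
  simpa using h1

/-- A continuous weak solution on an interval around the origin, transported to the interaction
picture, is an honest integral curve in `L²`. The loss of two derivatives disappears because
multiplication by the phase can be moved to the test function. -/
lemma hasDerivAt_of_weak {v : ℝ → L2} {T : ℝ} (hv : Continuous v)
    (hw : ∀ t ∈ Ioo (-T) T, ∀ ψ : 𝓢(ℝ, ℂ), ∃ d : ℂ,
      HasDerivAt (fun s => inner ℂ (conjS ψ) (v s)) d t ∧
      Complex.I * d - inner ℂ (conjS (dispS ψ)) (v t) =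
        lam * inner ℂ (conjS ψ) (mulOp (ind (Ici 0)) (fnl m B (v t)))) {t : ℝ}
    (ht : t ∈ Ioo (-T) T) :
    HasDerivAt (fun s => mulOp (phase disp s) (v s))
      (field m B lam (Ici 0) t (mulOp (phase disp t) (v t))) t := by
  set V : ℝ → L2 := fun s => mulOp (phase disp s) (v s) with hV
  have hVc : Continuous V := continuous_mulOp_phase_comp measurable_disp continuous_id hv
  set g : ℝ → L2 := fun s => field m B lam (Ici 0) s (V s) with hg
  have hgc : Continuous g := continuous_field_comp (Ici 0) hVc
  have hback : ∀ s, mulOp (phase disp (-s)) (V s) = v s := fun s => by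
    simp only [hV]
    rw [mulOp_phase_mulOp_phase measurable_disp, neg_add_cancel, mulOp_phase_zero]
  have hint : ∀ s, HasDerivAt (fun s => ∫ r in (0 : ℝ)..s, g r) (g s) s := fun s =>
    (hgc.integral_hasStrictDerivAt 0 s).hasDerivAt
  -- the weak derivative of `V`
  have hweak : ∀ ψ : 𝓢(ℝ, ℂ), HasCompactSupport ψ → ∀ s ∈ Ioo (-T) T,
      HasDerivAt (fun r => inner ℂ (conjS ψ) (V r)) (inner ℂ (conjS ψ) (g s)) s := by
    intro ψ hψ s hs
    obtain ⟨χ, hχ⟩ := exists_conjS_eq_phase hψ s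
    obtain ⟨d, hd, hd'⟩ := hw s hs χ
    have hA : HasDerivAt (fun r => mulOp (phase disp (-r)) (conjS ψ))
        (-mulOp (phase disp (-s)) (Complex.I • conjS (dispS ψ))) s := by
      have := (hasDerivAt_mulOp_phase measurable_disp
        ((mulEq_disp_conjS ψ).const_smul Complex.I) (-s)).scomp s (hasDerivAt_neg s)
      exact this.congr_deriv (by simp)
    have h1 := hasDerivAt_inner_of_weak hA hv.continuousAt (by rw [← hχ]; exact hd)
    have h2 : conjS (dispS χ) = mulOp (phase disp (-s)) (conjS (dispS ψ)) :=
      (mulEq_disp_conjS χ).unique (by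
        rw [hχ]
        exact (mulEq_disp_conjS ψ).mulOp (isMultiplier_phase measurable_disp (-s)))
    simp only [inner_mulOp_phase measurable_disp, neg_neg] at h1
    refine h1.congr_deriv ?_
    rw [h2, hχ] at hd'
    have h3 : inner ℂ (conjS ψ) (g s) = (-Complex.I * lam) *
        inner ℂ (mulOp (phase disp (-s)) (conjS ψ)) (mulOp (ind (Ici 0)) (fnl m B (v s))) := by
      rw [← hback s, ← inner_smul_right, ← mulOp_phase_neg_field _ measurableSet_Ici,
        inner_mulOp_phase measurable_disp, neg_neg, mulOp_phase_mulOp_phase measurable_disp,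
        add_neg_cancel, mulOp_phase_zero]
    rw [h3, map_smul, inner_neg_left, inner_smul_left, Complex.conj_I]
    linear_combination (-Complex.I) * hd' + d * Complex.I_mul_I
  have hzero : ∀ s ∈ Ioo (-T) T, V s - V 0 - ∫ r in (0 : ℝ)..s, g r = 0 := by
    intro s hs
    refine eq_zero_of_inner_conjS fun ψ hψ => ?_
    have h1 : ∀ r ∈ Ioo (-T) T, HasDerivAt
        (fun r => inner ℂ (conjS ψ) (V r - V 0 - ∫ q in (0 : ℝ)..r, g q)) 0 r := by
      intro r hr
      have h2 : HasDerivAt (fun r => inner ℂ (conjS ψ) (∫ q in (0 : ℝ)..r, g q))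
          (inner ℂ (conjS ψ) (g r)) r :=
        ((innerSL ℂ (conjS ψ)).restrictScalars ℝ).hasFDerivAt.comp_hasDerivAt r (hint r)
      have h3 := ((hweak ψ hψ r hr).sub_const (inner ℂ (conjS ψ) (V 0))).sub h2
      rw [sub_self] at h3
      refine h3.congr_of_eventuallyEq (Eventually.of_forall fun q => ?_)
      simp [inner_sub_right]
    have h0 : (0 : ℝ) ∈ Ioo (-T) T := ⟨by linarith [hs.1, hs.2], by linarith [hs.1, hs.2]⟩
    have h2 := (isOpen_Ioo).is_const_of_deriv_eq_zero (s := Ioo (-T) T) isPreconnected_Ioo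
      (fun r hr => (h1 r hr).differentiableAt.differentiableWithinAt)
      (fun r hr => (h1 r hr).deriv) hs h0
    rw [h2]
    simp
  have h1 := (hint t).const_add (V 0)
  refine h1.congr_of_eventuallyEq ?_
  filter_upwards [Ioo_mem_nhds ht.1 ht.2] with s hs
  have := hzero s hs
  rw [sub_sub] at this
  exact sub_eq_zero.1 this

/-! ### Existence and uniqueness -/

theorem exists_solution (m : ℝ≥0) (hlam : |lam| = 1) (u₀ : H1Plus) :
    ∃ u : C(ℝ, H1Plus), IsSolution m lam u ∧ u 0 = u₀ := by
  obtain ⟨K, -, hK⟩ := exists_bound_flow m (mulEq_hat u₀) (mulOp_ind_hat u₀)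
  obtain ⟨B, hB⟩ := exists_sup_bound (max ‖hat u₀‖ K)
  obtain ⟨V, hV0, hV⟩ := exists_flow (m := m) (B := B) hlam (measurableSet_Ici (a := (0 : ℝ)))
    (hat u₀)
  have hbd := hK B lam hlam V hV0 hV
  choose hVn W hVW hWK using hbd
  have hVs : ∀ t, mulOp (ind (Ici 0)) (V t) = V t :=
    mulOp_ind_flow measurableSet_Ici hV (by rw [hV0, mulOp_ind_hat])
  have hVc : Continuous V := continuous_iff_continuousAt.2 fun t => (hV t).continuousAt
  have hWc : Continuous W := continuous_freq_flow hlam hV hVs hVW hWK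
  have hph : ∀ t, IsMultiplier (phase disp (-t)) := fun t => isMultiplier_phase measurable_disp _
  set v : ℝ → L2 := fun t => mulOp (phase disp (-t)) (V t) with hv
  set w : ℝ → L2 := fun t => mulOp (phase disp (-t)) (W t) with hw
  have hvw : ∀ t, MulEq (fun x => (freq x : ℂ)) (v t) (w t) := fun t => (hVW t).mulOp (hph t)
  have hvs : ∀ t, mulOp (ind (Ici 0)) (v t) = v t := fun t => by
    simp only [hv]
    rw [mulOp_comm (isMultiplier_ind measurableSet_Ici) (hph t), hVs]
  have hvc : Continuous v := continuous_mulOp_phase_comp measurable_disp (by fun_prop) hVc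
  have hwc : Continuous w := continuous_mulOp_phase_comp measurable_disp (by fun_prop) hWc
  have huc : Continuous fun t => ofHat (v t) (w t) (hvw t) (hvs t) := by
    have hF : Continuous fun f : L2 => (𝓕⁻ f : L2) := (Lp.fourierTransformₗᵢ ℝ ℂ).symm.continuous
    refine Continuous.subtype_mk ?_ _
    exact (WithLp.prod_continuous_toLp 2 L2 L2).comp
      ((hF.comp hvc).prodMk (hF.comp (hwc.const_smul Complex.I)))
  have hhat : ∀ t, hat (ofHat (v t) (w t) (hvw t) (hvs t)) = v t := fun t => hat_ofHat _ _
  refine ⟨⟨_, huc⟩, (isSolution_iff m lam _).2 fun ψ t => ?_, ?_⟩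
  · have hsup : ∀ᵐ x, ‖toL2 (ofHat (v t) (w t) (hvw t) (hvs t)) x‖ ≤ B := by
      refine hB (v t) (w t) (hvw t) ?_ ?_
      · simp only [hv, norm_mulOp_phase measurable_disp]
        exact (hVn t).trans (le_max_left _ _)
      · simp only [hw, norm_mulOp_phase measurable_disp]
        exact (hWK t).trans (le_max_right _ _)
    simp only [ContinuousMap.coe_mk, hhat, fourier_szego_power m B _ hsup]
    exact hasDerivAt_inner_flow (hV t) (mulEq_disp_conjS ψ)
  · refine hat_injective ?_
    simp only [ContinuousMap.coe_mk, hhat]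
    simp [hv, hV0]

theorem solution_unique (m : ℝ≥0) (hlam : |lam| = 1) {u₁ u₂ : C(ℝ, H1Plus)}
    (h₁ : IsSolution m lam u₁) (h₂ : IsSolution m lam u₂) (h0 : u₁ 0 = u₂ 0) : u₁ = u₂ := by
  ext1 t
  set T : ℝ := |t| + 1 with hT
  have hT0 : 0 < T := by positivity
  have ht : t ∈ Ioo (-T) T := by
    rw [mem_Ioo, ← abs_lt, hT]; linarith
  -- on a compact interval the solutions are bounded, so that the truncation is not felt
  obtain ⟨K, hK⟩ : ∃ K : ℝ, ∀ s ∈ Icc (-T) T, ‖u₁ s‖ ≤ K ∧ ‖u₂ s‖ ≤ K := by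
    obtain ⟨K₁, hK₁⟩ := isCompact_Icc.exists_bound_of_continuousOn (s := Icc (-T) T)
      u₁.continuous.continuousOn
    obtain ⟨K₂, hK₂⟩ := isCompact_Icc.exists_bound_of_continuousOn (s := Icc (-T) T)
      u₂.continuous.continuousOn
    exact ⟨max K₁ K₂, fun s hs => ⟨(hK₁ s hs).trans (le_max_left _ _),
      (hK₂ s hs).trans (le_max_right _ _)⟩⟩
  obtain ⟨B, hB⟩ := exists_sup_bound K
  have key : ∀ u : C(ℝ, H1Plus), IsSolution m lam u → (∀ s ∈ Icc (-T) T, ‖u s‖ ≤ K) →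
      ∀ s ∈ Ioo (-T) T, HasDerivAt (fun s => mulOp (phase disp s) (hat (u s)))
        (field m B lam (Ici 0) s (mulOp (phase disp s) (hat (u s)))) s ∧
        mulOp (phase disp s) (hat (u s)) ∈ (univ : Set L2) := by
    intro u hu huK s hs
    refine ⟨hasDerivAt_of_weak (continuous_hat.comp u.continuous) (fun r hr ψ => ?_) hs, mem_univ _⟩
    have hb := huK r (Ioo_subset_Icc_self hr)
    have hsup : ∀ᵐ x, ‖toL2 (u r) x‖ ≤ B := by
      have := hB _ _ (mulEq_hat (u r)) ((norm_hat_le _).trans hb) ((norm_freqHat_le _).trans hb)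
      simpa only [hat, FourierTransform.fourierInv_fourier_eq] using this
    have := (isSolution_iff m lam u).1 hu ψ r
    rwa [fourier_szego_power m B _ hsup] at this
  have huniq := ODE_solution_unique_of_mem_Ioo (v := field m B lam (Ici 0)) (s := fun _ => univ)
    (t₀ := 0) (fun s _ => (lipschitzWith_field hlam measurableSet_Ici s).lipschitzOnWith)
    ⟨by linarith, hT0⟩ (key u₁ h₁ fun s hs => (hK s hs).1) (key u₂ h₂ fun s hs => (hK s hs).2)
    (by simp only [h0]) ht
  refine hat_injective ?_
  have h3 := congrArg (mulOp (phase disp (-t))) huniq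
  simpa only [mulOp_phase_mulOp_phase measurable_disp, neg_add_cancel, mulOp_phase_zero] using h3

end

end NLSSzego

end

theorem mainTheorem6 (m : ℝ≥0) (lam : ℝ) (hlam : lam = 1 ∨ lam = -1) (u₀ : NLSSzego.H1Plus) :
    ∃! u : C(ℝ, NLSSzego.H1Plus), NLSSzego.IsSolution m lam u ∧ u 0 = u₀ := by
  have hlam' : |lam| = 1 := by rcases hlam with rfl | rfl <;> simp
  obtain ⟨u, hu, hu0⟩ := NLSSzego.exists_solution m hlam' u₀
  exact ⟨u, ⟨hu, hu0⟩, fun w hw => NLSSzego.solution_unique m hlam' hw.1 hu (hw.2.trans hu0.symm)⟩
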